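/- Let $K$ be a field, let $R=K[x_1,\dots,x_m]$ and $S=K[y_1,\dots,y_n]$ be polynomial rings with the standard grading ($m,n\ge 0$, so $\dim R=m$ and $\dim S=n$), and let $Q=R\otimes_K S=K[x_1,\dots,x_m,y_1,\dots,y_n]$. Let $\mathfrak a\subset R$ and $\mathfrak b\subset S$ be proper homogeneous ideals that contain no non-zero linear forms, and put $A=R/\mathfrak a$, $B=S/\mathfrak b$. Regard $A$ as a graded $Q$-module on which every $y_j$ acts as zero, and $B$ as a graded $Q$-module on which every $x_i$ acts as zero. For a graded module $M$ over one of these polynomial rings $P$, let $\beta^P_{i,j}(M)=\dim_K[\operatorname{Tor}^P_i(M,K)]_j$ for $i\ge 0$, $j\in\mathbb Z$, and let $P^P_M(t,s)=\sum_{i,j\ge 0}\beta^P_{i,j}(M)\,t^is^j$. For a power series $F=\sum c_{ij}t^is^j$ let $\widetilde F=\sum_{j>i}c_{ij}t^is^j$ be the sum of its terms with $j>i$. Write $[x]_+=\max\{0,x\}$, and $\binom ab=0$ if $b>a$. Then the vector spaces $[\operatorname{Tor}_i(M,K)]_j$ are finite-dimensional for $M=A$ over $R$ and over $Q$ and for $M=B$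 over $S$ and over $Q$, and $$P^Q_A(t,s)=P^R_A(t,s)\,(1+st)^{n},\qquad P^Q_B(t,s)=P^S_B(t,s)\,(1+st)^{m},$$ $$\widetilde P^Q_A(t,s)=(P^R_A(t,s)-1)\,(1+st)^{n},\qquad \widetilde P^Q_B(t,s)=(P^S_B(t,s)-1)\,(1+st)^{m}.$$ Moreover, for all $i\ge 0$ and all $j\in\mathbb Z$ with $j\ne i$, $$\beta^Q_{i,j}(A)=\sum_{\ell=0}^{\min(i,m)-1}\binom{n}{[i-m]_++\ell}\,\beta^R_{\min(i,m)-\ell,\;j-\ell-[i-m]_+}(A),$$ $$\beta^Q_{i,j}(B)=\sum_{\ell=0}^{\min(i,n)-1}\binom{m}{[i-n]_++\ell}\,\beta^S_{\min(i,n)-\ell,\;j-\ell-[i-n]_+}(B),$$ while $\beta^Q_{i,i}(A)=\binom ni$ and $\beta^Q_{i,i}(B)=\binom mi$ for all $i\ge 0$. -/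

import Mathlib

open scoped TensorProduct

attribute [local instance] MvPolynomial.gradedAlgebra

noncomputable section

namespace GradedBetti

universe u

open MvPolynomial

/-- A criterion for a family of additive subgroups to decompose the ambient group. -/
theorem isInternal_of {M : Type*} [AddCommGroup M] (A : ℤ → AddSubgroup M)
    (hinj : ∀ (s : Finset ℤ) (x : ℤ → M), (∀ k, x k ∈ A k) → ∑ k ∈ s, x k = 0 →
      ∀ k ∈ s, x k = 0)
    (hsurj : ⨆ k, A k = ⊤) : DirectSum.IsInternal A := by
  classical
  constructor
  · rw [injective_iff_map_eq_zero]
    intro f hf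
    rw [DirectSum.coeAddMonoidHom_eq_dfinsuppSum, DFinsupp.sum] at hf
    have := hinj _ (fun k => (f k : M)) (fun k => (f k).2) hf
    ext k
    by_cases hk : k ∈ DFinsupp.support f
    · simpa using this k hk
    · simpa using hk
  · rw [← AddMonoidHom.range_eq_top, eq_top_iff, ← hsurj, iSup_le_iff]
    intro k x hx
    exact ⟨DirectSum.of (fun i => A i) k ⟨x, hx⟩, by simp⟩

theorem exists_sum_of_isInternal {M : Type*} [AddCommGroup M] {A : ℤ → AddSubgroup M}
    (h : DirectSum.IsInternal A) (x : M) :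
    ∃ (s : Finset ℤ) (y : ℤ → M), (∀ k, y k ∈ A k) ∧ ∑ k ∈ s, y k = x := by
  classical
  obtain ⟨f, hf⟩ := h.2 x
  rw [DirectSum.coeAddMonoidHom_eq_dfinsuppSum, DFinsupp.sum] at hf
  exact ⟨_, fun k => (f k : M), fun k => (f k).2, hf⟩

theorem eq_zero_of_isInternal {M : Type*} [AddCommGroup M] {A : ℤ → AddSubgroup M}
    (h : DirectSum.IsInternal A) (s : Finset ℤ) (x : ℤ → M) (hx : ∀ k, x k ∈ A k)
    (h0 : ∑ k ∈ s, x k = 0) : ∀ k ∈ s, x k = 0 := by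
  classical
  intro k hk
  have key : ∑ i ∈ s, DirectSum.of (fun i => A i) i ⟨x i, hx i⟩ = 0 := by
    apply h.1
    simp [map_sum, h0]
  have h1 := congrArg (DFinsupp.evalAddMonoidHom (β := fun i => A i) k) key
  rw [map_sum, map_zero] at h1
  have h2 : ∀ b ∈ s, b ≠ k → DFinsupp.evalAddMonoidHom (β := fun i => A i) k
      (DirectSum.of (fun i => A i) b ⟨x b, hx b⟩) = 0 :=
    fun b _ hb => DirectSum.of_eq_of_ne (β := fun i => A i) b k _ hb.symm
  rw [Finset.sum_eq_single k h2 (fun h => absurd hk h)] at h1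
  have h3 := DirectSum.of_eq_same (β := fun i => A i) k ⟨x k, hx k⟩
  exact congrArg Subtype.val (h3.symm.trans h1)

/-- A `ℤ`-graded module over the standard graded polynomial ring `K[x_i : i ∈ σ]`. -/
structure GrMod (σ : Type) (K : Type u) [Field K] where
  carrier : Type u
  [addCommGroup : AddCommGroup carrier]
  [module : Module (MvPolynomial σ K) carrier]
  piece : ℤ → AddSubgroup carrier
  isInternal : DirectSum.IsInternal piece
  smul_mem : ∀ (k : ℕ) (j : ℤ) (p : MvPolynomial σ K) (x : carrier),
    p.IsHomogeneous k → x ∈ piece j → p • x ∈ piece (k + j)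

attribute [instance] GrMod.addCommGroup GrMod.module

section Free

variable {σ : Type} {K : Type u} [Field K] {ι : Type u}

/-- The degree `j` part of the graded free module with a basis indexed by `ι`, the basis
element `b` having degree `deg b`: its elements are the `f` such that each `f b` is homogeneous
of degree `j - deg b` (thus zero if `j < deg b`). -/
def freePiece (σ : Type) (K : Type u) [Field K] (deg : ι → ℤ) (j : ℤ) :
    Submodule K (ι →₀ MvPolynomial σ K) where
  carrier := {f | ∀ b, ∀ e : σ →₀ ℕ, coeff e (f b) ≠ 0 → (e.degree : ℤ) + deg b = j}
  add_mem' := by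
    intro f g hf hg b e he
    by_cases h : coeff e (f b) = 0
    · refine hg b e fun h' => he ?_
      simp [h, h']
    · exact hf b e h
  zero_mem' := by
    intro b e he
    simp at he
  smul_mem' := by
    intro c f hf b e he
    refine hf b e fun h' => he ?_
    simp [h']

theorem freePiece_smul_mem (deg : ι → ℤ) (k : ℕ) (j : ℤ) (p : MvPolynomial σ K)
    (f : ι →₀ MvPolynomial σ K) (hp : p.IsHomogeneous k) (hf : f ∈ freePiece σ K deg j) :
    p • f ∈ freePiece σ K deg (k + j) := by
  classical
  intro b e he
  rw [Finsupp.smul_apply, smul_eq_mul, coeff_mul] at he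
  obtain ⟨⟨e1, e2⟩, h12, hne⟩ := Finset.exists_ne_zero_of_sum_ne_zero he
  have h1 : e1.degree = k := by
    have := hp (left_ne_zero_of_mul hne)
    rwa [Finsupp.degree_eq_weight_one]
  have h2 := hf b e2 (right_ne_zero_of_mul hne)
  rw [Finset.HasAntidiagonal.mem_antidiagonal] at h12
  simp only at h12
  rw [← h12, map_add, h1]
  push_cast
  omega

theorem free_isInternal (deg : ι → ℤ) :
    DirectSum.IsInternal (fun j => (freePiece σ K deg j).toAddSubgroup) := by
  classical
  apply isInternal_of
  · intro s x hx h0 k hk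
    ext b e
    by_contra hne
    have hk' : (e.degree : ℤ) + deg b = k := hx k b e hne
    have := congrArg (fun f : ι →₀ MvPolynomial σ K => coeff e (f b)) h0
    simp only [Finsupp.finsetSum_apply, coeff_sum, Finsupp.coe_zero, Pi.zero_apply,
      coeff_zero] at this
    rw [Finset.sum_eq_single k] at this
    · exact hne (by simpa using this)
    · intro l _ hl
      by_contra hl'
      exact hl ((hx l b e hl').symm.trans hk')
    · exact fun h => absurd hk h
  · rw [eq_top_iff]
    intro f hf
    clear hf
    induction f using Finsupp.induction_linear with
    | zero => exact zero_mem _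
    | add f g hf hg => exact add_mem hf hg
    | single b p =>
      induction p using MvPolynomial.induction_on' with
      | monomial e c =>
        refine AddSubgroup.mem_iSup_of_mem ((e.degree : ℤ) + deg b) ?_
        intro b' e' he'
        by_cases hb : b = b'
        · subst hb
          rw [Finsupp.single_eq_same, coeff_monomial] at he'
          by_cases hee : e = e'
          · rw [hee]
          · simp [hee] at he'
        · simp [Finsupp.single_eq_of_ne' hb] at he'
      | add p q hp hq =>
        rw [Finsupp.single_add]
        exact add_mem hp hq

end Free

variable {σ τ : Type} {K : Type u} [Field K]

/-- The irrelevant maximal ideal; the residue field is `K = P ⧸ irrelevant`, in degree `0`. -/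
abbrev irrelevant (σ : Type) (K : Type u) [Field K] : Ideal (MvPolynomial σ K) :=
  Ideal.span (Set.range X)

/-- A resolution of `M` by graded free modules and maps of degree `0`. -/
structure GradedFreeResolution (M : GrMod σ K) where
  gen : ℕ → Type u
  deg : ∀ i, gen i → ℤ
  d : ∀ i, (gen (i + 1) →₀ MvPolynomial σ K) →ₗ[MvPolynomial σ K] (gen i →₀ MvPolynomial σ K)
  aug : (gen 0 →₀ MvPolynomial σ K) →ₗ[MvPolynomial σ K] M.carrier
  d_mem : ∀ i j, ∀ f ∈ freePiece σ K (deg (i + 1)) j, d i f ∈ freePiece σ K (deg i) j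
  aug_mem : ∀ j, ∀ f ∈ freePiece σ K (deg 0) j, aug f ∈ M.piece j
  aug_surjective : Function.Surjective aug
  exact_zero : Function.Exact (d 0) aug
  exact_succ : ∀ i, Function.Exact (d (i + 1)) (d i)

/-! Every graded module has a graded free resolution: cover it by the graded free module on all
its homogeneous elements, and iterate with the kernel. -/

/-- The homogeneous elements of `M`. -/
abbrev GrMod.Homog (M : GrMod σ K) : Type u := Σ j : ℤ, M.piece j

/-- The canonical map onto `M` from the graded free module on its homogeneous elements. -/
def GrMod.cover (M : GrMod σ K) :
    (M.Homog →₀ MvPolynomial σ K) →ₗ[MvPolynomial σ K] M.carrier :=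
  Finsupp.linearCombination _ (fun b : M.Homog => (b.2 : M.carrier))

theorem GrMod.cover_mem (M : GrMod σ K) (j : ℤ) (f : M.Homog →₀ MvPolynomial σ K)
    (hf : f ∈ freePiece σ K (fun b : M.Homog => b.1) j) : M.cover f ∈ M.piece j := by
  rw [GrMod.cover, Finsupp.linearCombination_apply, Finsupp.sum]
  refine AddSubgroup.sum_mem _ fun b _ => ?_
  have key : ∀ e ∈ (f b).support, monomial e (coeff e (f b)) • (b.2 : M.carrier) ∈ M.piece j := by
    intro e he
    have h := M.smul_mem e.degree b.1 (monomial e (coeff e (f b))) b.2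
      (isHomogeneous_monomial _ rfl) b.2.2
    rwa [hf b e (mem_support_iff.mp he)] at h
  rw [(f b).as_sum, Finset.sum_smul]
  exact AddSubgroup.sum_mem _ key

theorem GrMod.cover_surjective (M : GrMod σ K) : Function.Surjective M.cover := by
  intro x
  obtain ⟨s, y, hy, rfl⟩ := exists_sum_of_isInternal M.isInternal x
  exact ⟨∑ k ∈ s, Finsupp.single ⟨k, ⟨y k, hy k⟩⟩ 1, by simp [GrMod.cover]⟩

/-- The kernel of the canonical cover, as a graded module. -/
def GrMod.syzygy (M : GrMod σ K) : GrMod σ K where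
  carrier := LinearMap.ker M.cover
  piece j := (freePiece σ K (fun b : M.Homog => b.1) j).toAddSubgroup.comap
    (LinearMap.ker M.cover).subtype.toAddMonoidHom
  isInternal := by
    apply isInternal_of
    · intro s x hx h0 k hk
      have := eq_zero_of_isInternal (free_isInternal (fun b : M.Homog => b.1)) s
        (fun k => (x k : M.Homog →₀ MvPolynomial σ K)) hx
        (by simpa using congrArg Subtype.val h0) k hk
      exact Subtype.ext this
    · rw [eq_top_iff]
      rintro ⟨x, hx⟩ -
      obtain ⟨s, y, hy, rfl⟩ := exists_sum_of_isInternal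
        (free_isInternal (fun b : M.Homog => b.1)) x
      have h0 := eq_zero_of_isInternal M.isInternal s (fun k => M.cover (y k))
        (fun k => M.cover_mem k _ (hy k)) (by rw [← map_sum]; exact hx)
      have : (⟨∑ k ∈ s, y k, hx⟩ : LinearMap.ker M.cover) =
          ∑ k ∈ s.attach, ⟨y k, h0 k k.2⟩ := by
        apply Subtype.ext
        rw [AddSubmonoidClass.coe_finsetSum]
        exact (Finset.sum_attach s y).symm
      rw [this]
      exact sum_mem fun k _ => AddSubgroup.mem_iSup_of_mem (k : ℤ) (hy k)
  smul_mem k j p x hp hx := freePiece_smul_mem _ k j p _ hp hx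

/-- The modules of syzygies of the canonical resolution. -/
def GrMod.syz (M : GrMod σ K) : ℕ → GrMod σ K
  | 0 => M
  | i + 1 => (GrMod.syz M i).syzygy

theorem GradedFreeResolution.nonempty (M : GrMod σ K) : Nonempty (GradedFreeResolution M) :=
  ⟨{ gen := fun i => (M.syz i).Homog
     deg := fun _ b => b.1
     d := fun i => (LinearMap.ker (M.syz i).cover).subtype ∘ₗ (M.syz (i + 1)).cover
     aug := M.cover
     d_mem := fun i j f hf => (M.syz (i + 1)).cover_mem j f hf
     aug_mem := M.cover_mem
     aug_surjective := M.cover_surjective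
     exact_zero := by
       intro y
       constructor
       · intro hy
         obtain ⟨f, hf⟩ := (M.syz 1).cover_surjective ⟨y, hy⟩
         exact ⟨f, congrArg Subtype.val hf⟩
       · rintro ⟨f, rfl⟩
         exact ((M.syz 1).cover f).2
     exact_succ := by
       intro i y
       constructor
       · intro hy
         obtain ⟨f, hf⟩ := (M.syz (i + 2)).cover_surjective ⟨y, Subtype.ext hy⟩
         exact ⟨f, congrArg Subtype.val hf⟩
       · rintro ⟨f, rfl⟩
         exact congrArg Subtype.val ((M.syz (i + 2)).cover f).2 }⟩

/-- `F ⊗ K` for the free module `F` with a basis indexed by `ι`, where `K = P ⧸ irrelevant`. -/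
def FreeTensor (σ : Type) (K : Type u) [Field K] (ι : Type u) : Type u :=
  (ι →₀ MvPolynomial σ K) ⊗[MvPolynomial σ K] (MvPolynomial σ K ⧸ irrelevant σ K)

instance (ι : Type u) : AddCommGroup (FreeTensor σ K ι) :=
  inferInstanceAs (AddCommGroup
    ((ι →₀ MvPolynomial σ K) ⊗[MvPolynomial σ K] (MvPolynomial σ K ⧸ irrelevant σ K)))

instance (ι : Type u) : Module K (FreeTensor σ K ι) :=
  inferInstanceAs (Module K
    ((ι →₀ MvPolynomial σ K) ⊗[MvPolynomial σ K] (MvPolynomial σ K ⧸ irrelevant σ K)))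

namespace GradedFreeResolution

variable {M : GrMod σ K} (F : GradedFreeResolution M)

/-- The degree `j` part of `F_i ⊗ K`. -/
def tensorPiece (i : ℕ) (j : ℤ) :
    Submodule K (FreeTensor σ K (F.gen i)) :=
  Submodule.span K {z | ∃ f ∈ freePiece σ K (F.deg i) j, ∃ c, z = f ⊗ₜ c}

/-- The differential of the complex `F ⊗ K`. -/
def tensorD (i : ℕ) :
    FreeTensor σ K (F.gen (i + 1)) →ₗ[K] FreeTensor σ K (F.gen i) :=
  ((F.d i).rTensor (MvPolynomial σ K ⧸ irrelevant σ K)).restrictScalars K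

/-- The cycles of degree `j` in `F_i ⊗ K`. -/
def cycles : (i : ℕ) → (j : ℤ) →
    Submodule K (FreeTensor σ K (F.gen i))
  | 0, j => F.tensorPiece 0 j
  | i + 1, j => F.tensorPiece (i + 1) j ⊓ LinearMap.ker (F.tensorD i)

/-- The boundaries of degree `j` in `F_i ⊗ K`. -/
def boundaries (i : ℕ) (j : ℤ) :
    Submodule K (FreeTensor σ K (F.gen i)) :=
  (F.tensorPiece (i + 1) j).map (F.tensorD i)

/-- The homology `[H_i(F ⊗ K)]_j`. -/
abbrev homology (i : ℕ) (j : ℤ) : Type u :=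
  F.cycles i j ⧸ (F.boundaries i j).submoduleOf (F.cycles i j)

end GradedFreeResolution

/-- `[Tor_i(M, K)]_j`, computed from a graded free resolution of `M`. -/
abbrev gradedTor (M : GrMod σ K) (i : ℕ) (j : ℤ) : Type u :=
  (Classical.choice (GradedFreeResolution.nonempty M)).homology i j

/-- The graded Betti number `β_{i,j}(M) = dim_K [Tor_i(M, K)]_j`. -/
def betti (M : GrMod σ K) (i : ℕ) (j : ℤ) : ℕ := Module.finrank K (gradedTor M i j)

/-- The variable `t` (homological degree) of bivariate power series. -/
abbrev tVar : MvPowerSeries (Fin 2) ℤ := MvPowerSeries.X 0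

/-- The variable `s` (internal degree) of bivariate power series. -/
abbrev sVar : MvPowerSeries (Fin 2) ℤ := MvPowerSeries.X 1

/-- The graded Poincaré series `∑ β_{i,j}(M) t^i s^j` (for `M` living in degrees `≥ 0`). -/
def poincare (M : GrMod σ K) : MvPowerSeries (Fin 2) ℤ :=
  fun e => (betti M (e 0) (e 1 : ℕ) : ℤ)

/-- The sum of the terms `c t^i s^j` of a power series that have `j > i`. -/
def strictPart (P : MvPowerSeries (Fin 2) ℤ) : MvPowerSeries (Fin 2) ℤ :=
  fun e => if e 0 < e 1 then MvPowerSeries.coeff e P else 0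

/-- The homogeneous polynomials of (integer) degree `j`. -/
def polyPiece (σ : Type) (K : Type u) [Field K] (j : ℤ) : AddSubgroup (MvPolynomial σ K) where
  carrier := {p | ∀ e : σ →₀ ℕ, coeff e p ≠ 0 → (e.degree : ℤ) = j}
  add_mem' := by
    intro f g hf hg e he
    by_cases h : coeff e f = 0
    · refine hg e fun h' => he ?_
      simp [h, h']
    · exact hf e h
  zero_mem' := by
    intro e he
    simp at he
  neg_mem' := by
    intro f hf e he
    refine hf e fun h' => he ?_
    simp [h']

theorem polyPiece_mul_mem (k : ℕ) (j : ℤ) (p q : MvPolynomial σ K)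
    (hp : p.IsHomogeneous k) (hq : q ∈ polyPiece σ K j) : p * q ∈ polyPiece σ K (k + j) := by
  classical
  intro e he
  rw [coeff_mul] at he
  obtain ⟨⟨e1, e2⟩, h12, hne⟩ := Finset.exists_ne_zero_of_sum_ne_zero he
  have h1 : e1.degree = k := by
    have := hp (left_ne_zero_of_mul hne)
    rwa [Finsupp.degree_eq_weight_one]
  have h2 := hq e2 (right_ne_zero_of_mul hne)
  rw [Finset.HasAntidiagonal.mem_antidiagonal] at h12
  simp only at h12
  rw [← h12, map_add, h1]
  push_cast
  omega

theorem mem_of_sum_mem (𝔞 : Ideal (MvPolynomial σ K))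
    (h𝔞 : 𝔞.IsHomogeneous (homogeneousSubmodule σ K)) (s : Finset ℤ)
    (p : ℤ → MvPolynomial σ K) (hp : ∀ k, p k ∈ polyPiece σ K k) (h : ∑ k ∈ s, p k ∈ 𝔞) :
    ∀ k ∈ s, p k ∈ 𝔞 := by
  classical
  intro k hk
  by_cases h0 : p k = 0
  · rw [h0]
    exact zero_mem _
  obtain ⟨e, he⟩ := MvPolynomial.ne_zero_iff.mp h0
  have hke := hp k e he
  have := h𝔞 e.degree h
  rw [← DirectSum.Decomposition.decompose'_eq, decomposition.decompose'_apply, map_sum,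
    Finset.sum_eq_single k] at this
  · rwa [homogeneousComponent_of_mem (m := e.degree) (n := e.degree), if_pos rfl] at this
    intro e' he'
    have := hp k e' he'
    have h3 : e'.degree = e.degree := by omega
    exact (DFunLike.congr_fun Finsupp.degree_eq_weight_one e').symm.trans h3
  · intro l _ hl
    ext e'
    rw [coeff_homogeneousComponent, coeff_zero]
    split_ifs with h'
    · by_contra hne
      have := hp l e' hne
      omega
    · rfl
  · exact fun h => absurd hk h

/-- The cyclic graded module `P ⧸ 𝔞` for a homogeneous ideal `𝔞` of the polynomial ring `P`. -/
def quotientMod (𝔞 : Ideal (MvPolynomial σ K))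
    (h𝔞 : 𝔞.IsHomogeneous (homogeneousSubmodule σ K)) : GrMod σ K where
  carrier := MvPolynomial σ K ⧸ 𝔞
  piece j := (polyPiece σ K j).map (Ideal.Quotient.mk 𝔞).toAddMonoidHom
  isInternal := by
    apply isInternal_of
    · intro s x hx h0 k hk
      choose p hp hpx using hx
      have h1 : ∀ k, Ideal.Quotient.mk 𝔞 (p k) = x k := hpx
      have := mem_of_sum_mem 𝔞 h𝔞 s p hp
        (by rw [← Ideal.Quotient.eq_zero_iff_mem, map_sum, Finset.sum_congr rfl fun k _ => h1 k, h0])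
        k hk
      rw [← h1, Ideal.Quotient.eq_zero_iff_mem]
      exact this
    · rw [eq_top_iff]
      intro x _
      obtain ⟨p, rfl⟩ := Ideal.Quotient.mk_surjective x
      induction p using MvPolynomial.induction_on' with
      | monomial e c =>
        classical
        refine AddSubgroup.mem_iSup_of_mem (e.degree : ℤ) ⟨monomial e c, ?_, rfl⟩
        intro e' he'
        rw [coeff_monomial] at he'
        by_cases hee : e = e'
        · rw [hee]
        · simp [hee] at he'
      | add p q hp hq =>
        rw [map_add]
        exact add_mem (hp trivial) (hq trivial)
  smul_mem := by
    rintro k j p _ hp ⟨q, hq, rfl⟩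
    exact ⟨p * q, polyPiece_mul_mem k j p q hp hq, rfl⟩

/-- Restriction of scalars of a graded module along a map of polynomial rings preserving
degrees. -/
def GrMod.restrict (f : MvPolynomial τ K →ₐ[K] MvPolynomial σ K)
    (hf : ∀ (k : ℕ) (p : MvPolynomial τ K), p.IsHomogeneous k → (f p).IsHomogeneous k)
    (M : GrMod σ K) : GrMod τ K where
  carrier := M.carrier
  module := Module.compHom M.carrier f.toRingHom
  piece := M.piece
  isInternal := M.isInternal
  smul_mem k j p x hp hx := M.smul_mem k j (f p) x (hf k p hp) hx

/-- The projection `K[x, y] → K[x]` that is the identity on the `x_i` and kills the `y_j`. -/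
def projLeft (σ τ : Type) (K : Type u) [Field K] :
    MvPolynomial (σ ⊕ τ) K →ₐ[K] MvPolynomial σ K :=
  aeval (Sum.elim X fun _ => 0)

/-- The projection `K[x, y] → K[y]` that is the identity on the `y_j` and kills the `x_i`. -/
def projRight (σ τ : Type) (K : Type u) [Field K] :
    MvPolynomial (σ ⊕ τ) K →ₐ[K] MvPolynomial τ K :=
  aeval (Sum.elim (fun _ => 0) X)

theorem projLeft_isHomogeneous (k : ℕ) (p : MvPolynomial (σ ⊕ τ) K) (hp : p.IsHomogeneous k) :
    (projLeft σ τ K p).IsHomogeneous k := by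
  have := hp.aeval (n := 1) (Sum.elim (X : σ → MvPolynomial σ K) fun _ : τ => 0) (by
    rintro (i | i)
    · exact isHomogeneous_X K i
    · exact isHomogeneous_zero σ K 1)
  rwa [one_mul] at this

theorem projRight_isHomogeneous (k : ℕ) (p : MvPolynomial (σ ⊕ τ) K) (hp : p.IsHomogeneous k) :
    (projRight σ τ K p).IsHomogeneous k := by
  have := hp.aeval (n := 1) (Sum.elim (fun _ : σ => 0) (X : τ → MvPolynomial τ K)) (by
    rintro (i | i)
    · exact isHomogeneous_zero τ K 1
    · exact isHomogeneous_X K i)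
  rwa [one_mul] at this

/-- `K[x] ⧸ 𝔞` as a graded module over `K[x, y] = K[x] ⊗ K[y]`, the `y_j` acting as zero. -/
def quotientModLeft (τ : Type) (𝔞 : Ideal (MvPolynomial σ K))
    (h𝔞 : 𝔞.IsHomogeneous (homogeneousSubmodule σ K)) : GrMod (σ ⊕ τ) K :=
  (quotientMod 𝔞 h𝔞).restrict (projLeft σ τ K) projLeft_isHomogeneous

/-- `K[y] ⧸ 𝔟` as a graded module over `K[x, y] = K[x] ⊗ K[y]`, the `x_i` acting as zero. -/
def quotientModRight (σ : Type) (𝔟 : Ideal (MvPolynomial τ K))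
    (h𝔟 : 𝔟.IsHomogeneous (homogeneousSubmodule τ K)) : GrMod (σ ⊕ τ) K :=
  (quotientMod 𝔟 h𝔟).restrict (projRight σ τ K) projRight_isHomogeneous

end GradedBetti

end

/-! Graded Tor is Koszul homology: `[Tor_i(M, K)]_j` is the homology in bidegree `(i, j)` of the
Koszul complex of `M` on all variables, built here as an iterated mapping cone (`Bicomplex.koszul`).
For any graded free resolution `F` of `M` there are quasi-isomorphisms `Kos(M) ← Kos(F) → F/(X)F`.
The left one exists because cones preserve quasi-isomorphisms (`Hom.IsQuasi.cone`). The right one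
exists because each variable is a nonzerodivisor on `F` modulo the other ones, so that its cone
amounts to division by it (`isQuasi_modVars_cone`). Finally `F/(X)F` is `F ⊗ K`. No comparison of
resolutions is needed.

Over `Q`, form the cones of the `x_i` first. This gives the Koszul complex of `A` over `R`, on which
the `y_j` still act as zero. The cone of a zero operator is the direct sum of the complex and its
shift by `(1, 1)` (`hdim_cone_of_zero`), so each `y_j` contributes a factor `1 + st`. This proves
the product formulas.

The remaining formulas depend on where `β^R(A)` vanishes. The Koszul complex on `m` variables lives
in `0 ≤ i ≤ m` and `j ≥ i`. Since `𝔞` is zero in degrees at most `1`, the Koszul complexes of `R`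
and `R/𝔞` agree for `j ≤ i + 1`, hence so do their homologies for `j ≤ i`, and that of `R` is `K` in
bidegree `(0, 0)`. In row `0`, right exactness leaves nothing else. So `P^R_A - 1` only has terms
with `j > i`, and multiplication by `1 + st` preserves `j - i`. -/

noncomputable section

namespace GradedBetti

universe u

open MvPolynomial

/-! ### Subquotients of vector spaces -/

section Subquotient

variable {K V W : Type*} [Field K] [AddCommGroup V] [Module K V] [AddCommGroup W] [Module K W]

/-- A linear map that induces a bijection between two subquotients gives an isomorphism. -/
theorem nonempty_subquotient_equiv {Z B : Submodule K V} {Z' B' : Submodule K W}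
    (f : V →ₗ[K] W) (hZ : ∀ z ∈ Z, f z ∈ Z') (hB : ∀ z ∈ B, f z ∈ B')
    (hinj : ∀ z ∈ Z, f z ∈ B' → z ∈ B)
    (hsurj : ∀ w ∈ Z', ∃ z ∈ Z, f z - w ∈ B') :
    Nonempty ((Z ⧸ B.submoduleOf Z) ≃ₗ[K] (Z' ⧸ B'.submoduleOf Z')) := by
  let g : (Z ⧸ B.submoduleOf Z) →ₗ[K] (Z' ⧸ B'.submoduleOf Z') :=
    Submodule.mapQ _ _ (f.restrict hZ) fun z hz => hB z hz
  refine ⟨LinearEquiv.ofBijective g ⟨?_, ?_⟩⟩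
  · rw [injective_iff_map_eq_zero]
    intro z hz
    obtain ⟨z, rfl⟩ := Submodule.Quotient.mk_surjective _ z
    rw [Submodule.Quotient.mk_eq_zero]
    change Submodule.Quotient.mk (f.restrict hZ z) = 0 at hz
    rw [Submodule.Quotient.mk_eq_zero] at hz
    exact hinj z z.2 hz
  · intro w
    obtain ⟨w, rfl⟩ := Submodule.Quotient.mk_surjective _ w
    obtain ⟨z, hz, hzw⟩ := hsurj w w.2
    refine ⟨Submodule.Quotient.mk ⟨z, hz⟩, ?_⟩
    change Submodule.Quotient.mk (f.restrict hZ ⟨z, hz⟩) = _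
    rw [Submodule.Quotient.eq]
    exact hzw

theorem finrank_subquotient_add {Z B : Submodule K V} (h : B ≤ Z) [Module.Finite K Z] :
    Module.finrank K (Z ⧸ B.submoduleOf Z) + Module.finrank K B = Module.finrank K Z := by
  rw [← (Submodule.submoduleOfEquivOfLe h).finrank_eq, Submodule.finrank_quotient_add_finrank]

/-- The product of two submodules is the direct product of their types. -/
def submoduleProdEquiv (p : Submodule K V) (q : Submodule K W) : p.prod q ≃ₗ[K] p × q where
  toFun z := (⟨z.1.1, z.2.1⟩, ⟨z.1.2, z.2.2⟩)
  invFun z := ⟨(z.1, z.2), z.1.2, z.2.2⟩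
  map_add' _ _ := rfl
  map_smul' _ _ := rfl

theorem finrank_subquotient_prod {Z B : Submodule K V} {Z' B' : Submodule K W}
    (h : B ≤ Z) (h' : B' ≤ Z') [Module.Finite K Z] [Module.Finite K Z'] :
    Module.finrank K (Z.prod Z' ⧸ (B.prod B').submoduleOf (Z.prod Z')) =
      Module.finrank K (Z ⧸ B.submoduleOf Z) + Module.finrank K (Z' ⧸ B'.submoduleOf Z') := by
  have : Module.Finite K B := Submodule.finiteDimensional_of_le h
  have : Module.Finite K B' := Submodule.finiteDimensional_of_le h'
  have : Module.Finite K (Z.prod Z') := Module.Finite.equiv (submoduleProdEquiv Z Z').symm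
  have h1 := finrank_subquotient_add h
  have h2 := finrank_subquotient_add h'
  have h3 := finrank_subquotient_add (Submodule.prod_mono h h')
  rw [(submoduleProdEquiv Z Z').finrank_eq, (submoduleProdEquiv B B').finrank_eq,
    Module.finrank_prod, Module.finrank_prod] at h3
  omega

end Subquotient

/-- Pascal's rule. It drives two inductions, on the number of operators acting as zero (over `ℕ`)
and on the exponent of `1 + st` (over `ℤ`). -/
theorem sum_choose_succ_mul {R : Type*} [CommSemiring R] (n : ℕ) (g : ℤ → ℤ → R) (i j : ℤ) :
    ∑ k ∈ Finset.range (n + 1 + 1), ((n + 1).choose k : R) * g (i - k) (j - k) =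
      ∑ k ∈ Finset.range (n + 1), (n.choose k : R) *
        (g (i - k) (j - k) + g (i - k - 1) (j - k - 1)) := by
  rw [Finset.sum_range_succ']
  simp only [Nat.choose_succ_succ, Nat.cast_add, add_mul, mul_add, Finset.sum_add_distrib]
  rw [Finset.sum_range_succ (fun k => (n.choose (k + 1) : R) * _) n,
    Finset.sum_range_succ' (fun k => (n.choose k : R) * g (i - k) (j - k))]
  have : ∀ x : ℕ, g (i - x - 1) (j - x - 1) = g (i - (x + 1 : ℕ)) (j - (x + 1 : ℕ)) := by
    intro x
    congr 1 <;> push_cast <;> ring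
  simp only [this, Nat.choose_succ_self, Nat.choose_zero_right, Nat.cast_zero,
    zero_mul, add_zero, Nat.cast_add, Nat.cast_one]
  ring

/-! ### Bigraded complexes, their homology and quasi-isomorphisms -/

/-- A bigraded complex of `K`-vector spaces (homological degree `i`, internal degree `j`) with
commuting operators `x s` of bidegree `(0, 1)`. Only the bihomogeneous parts `piece i j` of the
carrier matter. -/
structure Bicomplex (σ : Type) (K : Type u) [Field K] where
  carrier : Type u
  [addCommGroup : AddCommGroup carrier]
  [module : Module K carrier]
  d : carrier →ₗ[K] carrier
  x : σ → carrier →ₗ[K] carrier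
  piece : ℤ → ℤ → Submodule K carrier
  d_d : ∀ a, d (d a) = 0
  x_d : ∀ s a, x s (d a) = d (x s a)
  x_x : ∀ s t a, x s (x t a) = x t (x s a)
  d_mem : ∀ i j a, a ∈ piece i j → d a ∈ piece (i - 1) j
  x_mem : ∀ s i j a, a ∈ piece i j → x s a ∈ piece i (j + 1)

attribute [instance] Bicomplex.addCommGroup Bicomplex.module

namespace Bicomplex

variable {σ τ : Type} {K : Type u} [Field K]

section Homology

variable (C : Bicomplex σ K)

def cycles (i j : ℤ) : Submodule K C.carrier := C.piece i j ⊓ LinearMap.ker C.d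

def boundaries (i j : ℤ) : Submodule K C.carrier := (C.piece (i + 1) j).map C.d

theorem boundaries_le_cycles (i j : ℤ) : C.boundaries i j ≤ C.cycles i j := by
  rintro _ ⟨a, ha, rfl⟩
  refine ⟨?_, C.d_d a⟩
  have := C.d_mem _ _ a ha
  rwa [add_sub_cancel_right] at this

abbrev homology (i j : ℤ) : Type u := C.cycles i j ⧸ (C.boundaries i j).submoduleOf (C.cycles i j)

/-- The dimension of the homology in bidegree `(i, j)`. -/
def hdim (i j : ℤ) : ℕ := Module.finrank K (C.homology i j)

/-- All the bihomogeneous parts are finite-dimensional. -/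
def LocallyFinite : Prop := ∀ i j, Module.Finite K (C.piece i j)

variable {C}

theorem LocallyFinite.cycles (h : C.LocallyFinite) (i j : ℤ) : Module.Finite K (C.cycles i j) :=
  have := h i j
  Submodule.finiteDimensional_of_le inf_le_left

theorem LocallyFinite.homology (h : C.LocallyFinite) (i j : ℤ) :
    Module.Finite K (C.homology i j) :=
  have := h.cycles i j
  inferInstance

theorem hdim_eq_zero {i j : ℤ} (h : C.piece i j = ⊥) : C.hdim i j = 0 := by
  have h0 : C.cycles i j = ⊥ := by rw [Bicomplex.cycles, h, bot_inf_eq]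
  have : Subsingleton (C.cycles i j) := by rw [h0]; infer_instance
  have : Subsingleton (C.homology i j) := (Submodule.mkQ_surjective _).subsingleton
  exact Module.finrank_zero_of_subsingleton

end Homology

/-- A map of bigraded complexes. -/
structure Hom (C D : Bicomplex σ K) where
  f : C.carrier →ₗ[K] D.carrier
  f_d : ∀ a, f (C.d a) = D.d (f a)
  f_x : ∀ s a, f (C.x s a) = D.x s (f a)
  f_mem : ∀ i j a, a ∈ C.piece i j → f a ∈ D.piece i j

/-- A map of bigraded complexes that is bijective on homology. -/
structure Hom.IsQuasi {C D : Bicomplex σ K} (φ : Hom C D) : Prop where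
  inj : ∀ i j, ∀ a ∈ C.piece i j, C.d a = 0 → ∀ w ∈ D.piece (i + 1) j, φ.f a = D.d w →
    ∃ u ∈ C.piece (i + 1) j, C.d u = a
  surj : ∀ i j, ∀ w ∈ D.piece i j, D.d w = 0 →
    ∃ a ∈ C.piece i j, C.d a = 0 ∧ ∃ v ∈ D.piece (i + 1) j, φ.f a = w + D.d v

theorem Hom.mem_cycles {C D : Bicomplex σ K} (φ : Hom C D) (i j : ℤ) :
    ∀ z ∈ C.cycles i j, φ.f z ∈ D.cycles i j := by
  rintro z ⟨hz, hz0 : C.d z = 0⟩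
  exact ⟨φ.f_mem i j z hz, show D.d (φ.f z) = 0 by rw [← φ.f_d, hz0, map_zero]⟩

theorem Hom.IsQuasi.nonempty_equiv {C D : Bicomplex σ K} {φ : Hom C D} (h : φ.IsQuasi)
    (i j : ℤ) : Nonempty (C.homology i j ≃ₗ[K] D.homology i j) := by
  refine nonempty_subquotient_equiv φ.f (φ.mem_cycles i j) ?_ ?_ ?_
  · rintro _ ⟨a, ha, rfl⟩
    exact ⟨φ.f a, φ.f_mem _ _ a ha, (φ.f_d a).symm⟩
  · rintro z ⟨hz, hz0⟩ ⟨w, hw, hwz⟩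
    exact h.inj i j z hz hz0 w hw hwz.symm
  · rintro w ⟨hw, hw0⟩
    obtain ⟨a, ha, ha0, v, hv, hav⟩ := h.surj i j w hw hw0
    exact ⟨a, ⟨ha, ha0⟩, v, hv, by rw [hav, add_sub_cancel_left]⟩

theorem Hom.IsQuasi.hdim_eq {C D : Bicomplex σ K} {φ : Hom C D} (h : φ.IsQuasi)
    (i j : ℤ) : C.hdim i j = D.hdim i j :=
  (h.nonempty_equiv i j).elim LinearEquiv.finrank_eq

theorem Hom.isQuasi_of_bijective {C D : Bicomplex σ K} (φ : Hom C D)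
    (hinj : ∀ i j, ∀ a ∈ C.piece i j, φ.f a = 0 → a = 0)
    (hsurj : ∀ i j, ∀ w ∈ D.piece i j, ∃ a ∈ C.piece i j, φ.f a = w) : φ.IsQuasi where
  inj i j a ha _ w hw haw := by
    obtain ⟨u, hu, rfl⟩ := hsurj _ _ w hw
    refine ⟨u, hu, ?_⟩
    rw [← φ.f_d, ← sub_eq_zero, ← map_sub] at haw
    have := C.d_mem _ _ u hu
    rw [add_sub_cancel_right] at this
    exact (sub_eq_zero.mp (hinj i j _ (sub_mem ha this) haw)).symm
  surj i j w hw hw0 := by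
    obtain ⟨a, ha, rfl⟩ := hsurj _ _ w hw
    refine ⟨a, ha, ?_, 0, zero_mem _, by simp⟩
    rw [← φ.f_d] at hw0
    exact hinj _ _ _ (C.d_mem _ _ a ha) hw0

/-! ### Mapping cones -/

section Cone

/-- The mapping cone of the operator `x s`. -/
def cone (s : σ) (C : Bicomplex σ K) : Bicomplex σ K where
  carrier := C.carrier × C.carrier
  -- The sign makes the square zero, because `x s` commutes with `d`.
  d := (C.d.coprod (C.x s)).prod (-(C.d ∘ₗ LinearMap.snd K _ _))
  x t := (C.x t).prodMap (C.x t)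
  -- The second copy is shifted by one in `i`, as in any cone, and by one in `j` to compensate the
  -- degree of `x s`.
  piece i j := (C.piece i j).prod (C.piece (i - 1) (j - 1))
  d_d := by
    rintro ⟨a, b⟩
    simp [C.d_d, C.x_d]
  x_d := by
    rintro t ⟨a, b⟩
    simp [C.x_d, C.x_x t s]
  x_x := by
    rintro t t' ⟨a, b⟩
    simp [C.x_x t t']
  d_mem := by
    rintro i j ⟨a, b⟩ ⟨ha, hb⟩
    refine ⟨add_mem (C.d_mem _ _ a ha) ?_, neg_mem (C.d_mem _ _ b hb)⟩
    have := C.x_mem s _ _ b hb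
    rwa [sub_add_cancel] at this
  x_mem := by
    rintro t i j ⟨a, b⟩ ⟨ha, hb⟩
    refine ⟨C.x_mem t _ _ a ha, ?_⟩
    have := C.x_mem t _ _ b hb
    rwa [sub_add_eq_add_sub] at this

variable {C D : Bicomplex σ K}

theorem cone_d_apply (s : σ) (a b : C.carrier) :
    (cone s C).d (a, b) = (C.d a + C.x s b, -C.d b) := rfl

def Hom.cone (s : σ) (φ : Hom C D) : Hom (C.cone s) (D.cone s) where
  f := φ.f.prodMap φ.f
  f_d := by
    rintro ⟨a, b⟩
    refine Prod.ext ?_ ?_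
    · change φ.f (C.d a + C.x s b) = D.d (φ.f a) + D.x s (φ.f b)
      rw [map_add, φ.f_d, φ.f_x]
    · change φ.f (-C.d b) = -D.d (φ.f b)
      rw [map_neg, φ.f_d]
  f_x := by
    rintro t ⟨a, b⟩
    exact Prod.ext (φ.f_x t a) (φ.f_x t b)
  f_mem := by
    rintro i j ⟨a, b⟩ ⟨ha, hb⟩
    exact ⟨φ.f_mem _ _ a ha, φ.f_mem _ _ b hb⟩

/-- This is the five lemma for the long exact sequences of the two cones, carried out as a chase
with bihomogeneous elements. -/
theorem Hom.IsQuasi.cone {φ : Hom C D} (h : φ.IsQuasi) (s : σ) : (φ.cone s).IsQuasi where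
  inj := by
    rintro i j ⟨a, b⟩ ⟨ha, hb⟩ hab ⟨w, v⟩ ⟨hw, hv⟩ hwv
    obtain ⟨hab, hb0⟩ := Prod.ext_iff.mp hab
    obtain ⟨hw', hv'⟩ := Prod.ext_iff.mp hwv
    change a ∈ C.piece i j at ha
    change b ∈ C.piece (i - 1) (j - 1) at hb
    change w ∈ D.piece (i + 1) j at hw
    change v ∈ D.piece (i + 1 - 1) (j - 1) at hv
    change C.d a + C.x s b = 0 at hab
    change -C.d b = 0 at hb0
    change φ.f a = D.d w + D.x s v at hw'
    change φ.f b = -D.d v at hv'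
    rw [add_sub_cancel_right] at hv
    rw [neg_eq_zero] at hb0
    obtain ⟨u, hu, hub⟩ := h.inj (i - 1) (j - 1) b hb hb0 (-v)
      (by rw [sub_add_cancel]; exact neg_mem hv) (by rw [hv', map_neg])
    rw [sub_add_cancel] at hu
    -- A primitive `u` of `b` is determined only up to cycles. The cycle `v + φ u` is the
    -- obstruction to finishing with `-u`; lifting it to `c` and using `u - c` removes it up to the
    -- boundary of `y`.
    obtain ⟨c, hc, hc0, y, hy, hcy⟩ := h.surj i (j - 1) (v + φ.f u)
      (add_mem hv (φ.f_mem _ _ u hu)) (by rw [map_add, ← φ.f_d, hub, hv', add_neg_cancel])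
    have hxu := C.x_mem s _ _ (u - c) (sub_mem hu hc)
    have hxy := D.x_mem s _ _ y hy
    rw [sub_add_cancel] at hxu hxy
    obtain ⟨a', ha', haa'⟩ := h.inj i j (a + C.x s (u - c)) (add_mem ha hxu)
      (by rw [map_add, ← C.x_d, map_sub, hub, hc0, sub_zero, hab]) (w - D.x s y)
      (sub_mem hw hxy) (by
        rw [map_add, hw', φ.f_x, map_sub, hcy]
        simp only [map_add, map_sub, D.x_d]
        abel)
    refine ⟨(a', -(u - c)), ⟨ha', ?_⟩, ?_⟩
    · rw [add_sub_cancel_right]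
      exact neg_mem (sub_mem hu hc)
    · rw [cone_d_apply, haa']
      refine Prod.ext ?_ ?_
      · change a + C.x s (u - c) + C.x s (-(u - c)) = a
        rw [map_neg, add_neg_cancel_right]
      · change -C.d (-(u - c)) = b
        rw [map_neg, neg_neg, map_sub, hub, hc0, sub_zero]
  surj := by
    rintro i j ⟨w, v⟩ ⟨hw, hv⟩ hwv
    obtain ⟨hw', hv'⟩ := Prod.ext_iff.mp hwv
    change w ∈ D.piece i j at hw
    change v ∈ D.piece (i - 1) (j - 1) at hv
    change D.d w + D.x s v = 0 at hw'
    change -D.d v = 0 at hv'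
    rw [neg_eq_zero] at hv'
    -- Lift `v` to a cycle `b`. Then `x s b` maps to the boundary of `x s y - w`, so it is itself a
    -- boundary `d a`, and it remains to lift the cycle `w - x s y + φ a`.
    obtain ⟨b, hb, hb0, y, hy, hby⟩ := h.surj _ _ v hv hv'
    rw [sub_add_cancel] at hy
    have hxb := C.x_mem s _ _ b hb
    have hxy := D.x_mem s _ _ y hy
    rw [sub_add_cancel] at hxb hxy
    obtain ⟨a, ha, hab⟩ := h.inj (i - 1) j (C.x s b) hxb (by rw [← C.x_d, hb0, map_zero])
      (D.x s y - w) (by rw [sub_add_cancel]; exact sub_mem hxy hw) (by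
        rw [φ.f_x, hby, map_add, map_sub, D.x_d, eq_neg_of_add_eq_zero_left hw']
        abel)
    rw [sub_add_cancel] at ha
    obtain ⟨c, hc, hc0, z, hz, hcz⟩ := h.surj i j (w - D.x s y + φ.f a)
      (add_mem (sub_mem hw hxy) (φ.f_mem _ _ a ha)) (by
        rw [map_add, map_sub, ← φ.f_d, hab, φ.f_x, hby, ← D.x_d, map_add,
          eq_neg_of_add_eq_zero_left hw']
        abel)
    refine ⟨(c - a, b), ⟨sub_mem hc ha, hb⟩, ?_, (z, -y), ⟨hz, ?_⟩, ?_⟩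
    · rw [cone_d_apply]
      refine Prod.ext ?_ ?_
      · change C.d (c - a) + C.x s b = 0
        rw [map_sub, hc0, hab, zero_sub, neg_add_cancel]
      · change -C.d b = 0
        rw [hb0, neg_zero]
    · rw [add_sub_cancel_right]
      exact neg_mem hy
    · refine Prod.ext ?_ ?_
      · change φ.f (c - a) = w + (D.d z + D.x s (-y))
        rw [map_sub, hcz, map_neg]
        abel
      · change φ.f b = v + -D.d (-y)
        rw [hby, map_neg, neg_neg]

/-- A surjection `C → D` with kernel `x s C`, where `x s` is injective, induces a
quasi-isomorphism from the cone of `x s`. -/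
def Hom.ofCone (s : σ) (φ : Hom C D) (h0 : ∀ a, φ.f (C.x s a) = 0) : Hom (C.cone s) D where
  f := φ.f ∘ₗ LinearMap.fst K _ _
  f_d := by
    rintro ⟨a, b⟩
    change φ.f (C.d a + C.x s b) = D.d (φ.f a)
    rw [map_add, h0, add_zero, φ.f_d]
  f_x := by
    rintro t ⟨a, b⟩
    exact φ.f_x t a
  f_mem := by
    rintro i j ⟨a, b⟩ ⟨ha, hb⟩
    exact φ.f_mem _ _ a ha

/-- The hypotheses are a short exact sequence `0 → C → C → D → 0` whose first map is `x s`. The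
second component of a cone element is recovered from the first by cancelling the injective operator
`x s`. -/
theorem Hom.isQuasi_ofCone (s : σ) (φ : Hom C D) (h0 : ∀ a, φ.f (C.x s a) = 0)
    (hinj : ∀ a, C.x s a = 0 → a = 0)
    (hker : ∀ i j, ∀ a ∈ C.piece i j, φ.f a = 0 → ∃ b ∈ C.piece i (j - 1), C.x s b = a)
    (hsurj : ∀ i j, ∀ w ∈ D.piece i j, ∃ a ∈ C.piece i j, φ.f a = w) :
    (φ.ofCone s h0).IsQuasi where
  inj := by
    rintro i j ⟨a, b⟩ ⟨ha, hb⟩ hab w hw hwa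
    obtain ⟨hab, -⟩ := Prod.ext_iff.mp hab
    change a ∈ C.piece i j at ha
    change C.d a + C.x s b = 0 at hab
    change φ.f a = D.d w at hwa
    obtain ⟨u, hu, rfl⟩ := hsurj _ _ w hw
    have hdu := C.d_mem _ _ u hu
    rw [add_sub_cancel_right] at hdu
    obtain ⟨c, hc, hca⟩ := hker i j (a - C.d u) (sub_mem ha hdu)
      (by rw [map_sub, hwa, φ.f_d, sub_self])
    refine ⟨(u, c), ⟨hu, by rwa [add_sub_cancel_right]⟩, ?_⟩
    rw [cone_d_apply, hca]
    refine Prod.ext (by simp) ?_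
    change -C.d c = b
    rw [← sub_eq_zero]
    apply hinj
    have h1 : C.x s (C.d c) = C.d a := by rw [C.x_d, hca, map_sub, C.d_d, sub_zero]
    rw [map_sub, map_neg, h1, sub_eq_add_neg, ← neg_add, hab, neg_zero]
  surj := by
    intro i j w hw hw0
    obtain ⟨a, ha, rfl⟩ := hsurj _ _ w hw
    obtain ⟨b, hb, hba⟩ := hker _ _ (C.d a) (C.d_mem _ _ a ha) (by rw [φ.f_d, hw0])
    refine ⟨(a, -b), ⟨ha, neg_mem hb⟩, ?_, 0, zero_mem _, ?_⟩
    · rw [cone_d_apply]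
      refine Prod.ext ?_ ?_
      · change C.d a + C.x s (-b) = 0
        rw [map_neg, hba, add_neg_cancel]
      change -C.d (-b) = 0
      rw [map_neg, neg_neg]
      apply hinj
      rw [C.x_d, hba, C.d_d]
    · change φ.f a = φ.f a + D.d 0
      simp

theorem LocallyFinite.cone (h : C.LocallyFinite) (s : σ) : (C.cone s).LocallyFinite := by
  intro i j
  have := h i j
  have := h (i - 1) (j - 1)
  exact Module.Finite.equiv (submoduleProdEquiv (C.piece i j) (C.piece (i - 1) (j - 1))).symm

/-- When `x s = 0` the cone differential is `(d, -d)`, so the cone is the direct sum of `C` and its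
shift; the sign does not affect cycles or boundaries. -/
theorem hdim_cone_of_zero (h : C.LocallyFinite) {s : σ} (hs : C.x s = 0) (i j : ℤ) :
    (C.cone s).hdim i j = C.hdim i j + C.hdim (i - 1) (j - 1) := by
  have hZ : (C.cone s).cycles i j = (C.cycles i j).prod (C.cycles (i - 1) (j - 1)) := by
    ext ⟨a, b⟩
    change (a ∈ C.piece i j ∧ b ∈ C.piece (i - 1) (j - 1)) ∧ (C.d a + C.x s b, -C.d b) = 0 ↔
      (a ∈ C.piece i j ∧ C.d a = 0) ∧ b ∈ C.piece (i - 1) (j - 1) ∧ C.d b = 0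
    rw [hs, LinearMap.zero_apply, add_zero, Prod.mk_eq_zero, neg_eq_zero]
    tauto
  have hB : (C.cone s).boundaries i j = (C.boundaries i j).prod (C.boundaries (i - 1) (j - 1)) := by
    ext ⟨a, b⟩
    constructor
    · rintro ⟨⟨u, v⟩, ⟨hu, hv⟩, huv⟩
      obtain ⟨h1, h2⟩ := Prod.ext_iff.mp huv
      change C.d u + C.x s v = a at h1
      change -C.d v = b at h2
      rw [hs, LinearMap.zero_apply, add_zero] at h1
      refine ⟨⟨u, hu, h1⟩, -v, ?_, by rw [map_neg, h2]⟩
      rw [sub_add_eq_add_sub]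
      exact neg_mem hv
    · rintro ⟨⟨u, hu, h1 : C.d u = a⟩, ⟨v, hv, h2 : C.d v = b⟩⟩
      rw [sub_add_eq_add_sub] at hv
      refine ⟨(u, -v), ⟨hu, neg_mem hv⟩, Prod.ext ?_ ?_⟩
      · change C.d u + C.x s (-v) = a
        rw [hs, LinearMap.zero_apply, add_zero, h1]
      · change -C.d (-v) = b
        rw [map_neg, neg_neg, h2]
  have := h.cycles i j
  have := h.cycles (i - 1) (j - 1)
  have := finrank_subquotient_prod (C.boundaries_le_cycles i j)
    (C.boundaries_le_cycles (i - 1) (j - 1))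
  rw [hdim, hdim, hdim, ← this]
  unfold homology
  rw [hZ, hB]
  rfl

end Cone

/-! ### Koszul complexes as iterated cones -/

/-- The iterated cone of the operators in `l`, starting from the complex `C`. -/
def koszul : List σ → Bicomplex σ K → Bicomplex σ K
  | [], C => C
  | s :: l, C => koszul l (C.cone s)

def Hom.koszul : (l : List σ) → {C D : Bicomplex σ K} → Hom C D → Hom (koszul l C) (koszul l D)
  | [], _, _, φ => φ
  | s :: l, _, _, φ => Hom.koszul l (φ.cone s)

theorem Hom.IsQuasi.koszul (l : List σ) {C D : Bicomplex σ K} {φ : Hom C D} (h : φ.IsQuasi) :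
    (φ.koszul l).IsQuasi := by
  induction l generalizing C D with
  | nil => exact h
  | cons s l ih => exact ih (h.cone s)

theorem LocallyFinite.koszul (l : List σ) {C : Bicomplex σ K} (h : C.LocallyFinite) :
    (koszul l C).LocallyFinite := by
  induction l generalizing C with
  | nil => exact h
  | cons s l ih => exact ih (h.cone s)

theorem koszul_append (l l' : List σ) (C : Bicomplex σ K) :
    koszul (l ++ l') C = koszul l' (koszul l C) := by
  induction l generalizing C with
  | nil => rfl
  | cons s l ih => exact ih _

theorem koszul_x_eq_zero (l : List σ) {C : Bicomplex σ K} {s : σ} (h : C.x s = 0) :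
    (koszul l C).x s = 0 := by
  induction l generalizing C with
  | nil => exact h
  | cons t l ih =>
    apply ih
    exact LinearMap.ext fun a => Prod.ext (LinearMap.congr_fun h a.1) (LinearMap.congr_fun h a.2)

theorem cone_piece_eq_bot {C : Bicomplex σ K} {i j : ℤ} (s : σ) (h : C.piece i j = ⊥)
    (h' : C.piece (i - 1) (j - 1) = ⊥) : (C.cone s).piece i j = ⊥ := by
  change (C.piece i j).prod (C.piece (i - 1) (j - 1)) = ⊥
  rw [h, h', Submodule.prod_bot]

/-- A cone raises the top homological degree by one and, since it shifts `i` and `j` together, keeps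
the lower bound for `j - i`. -/
theorem koszul_piece_eq_bot (l : List σ) {C : Bicomplex σ K} {a b : ℤ}
    (h : ∀ i j, i < 0 ∨ a < i ∨ j < i + b → C.piece i j = ⊥) :
    ∀ i j, i < 0 ∨ a + l.length < i ∨ j < i + b → (koszul l C).piece i j = ⊥ := by
  induction l generalizing C a with
  | nil =>
    intro i j hij
    exact h i j (by simpa using hij)
  | cons s l ih =>
    have := ih (C := C.cone s) (a := a + 1) (fun i j hij => ?_)
    · intro i j hij
      apply this
      rw [List.length_cons] at hij
      push_cast at hij
      omega
    · exact cone_piece_eq_bot s (h _ _ (by omega)) (h _ _ (by omega))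

/-- Koszul homology with respect to operators that act as zero. -/
theorem hdim_koszul_of_zero (l : List σ) {C : Bicomplex σ K} (h : C.LocallyFinite)
    (hl : ∀ s ∈ l, C.x s = 0) (i j : ℤ) :
    (koszul l C).hdim i j =
      ∑ k ∈ Finset.range (l.length + 1), l.length.choose k * C.hdim (i - k) (j - k) := by
  induction l generalizing C with
  | nil => simp [koszul]
  | cons s l ih =>
    have hs := hl s (by simp)
    have h2 : ∀ t ∈ l, (C.cone s).x t = 0 := fun t ht =>
      koszul_x_eq_zero [s] (hl t (by simp [ht]))
    rw [koszul, ih (h.cone s) h2]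
    simp only [hdim_cone_of_zero h hs, List.length_cons]
    exact (sum_choose_succ_mul _ _ i j).symm

/-- Reindexing of the operators. -/
def reindex (f : τ → σ) (C : Bicomplex σ K) : Bicomplex τ K where
  carrier := C.carrier
  d := C.d
  x s := C.x (f s)
  piece := C.piece
  d_d := C.d_d
  x_d s := C.x_d (f s)
  x_x s t := C.x_x (f s) (f t)
  d_mem := C.d_mem
  x_mem s := C.x_mem (f s)

/-- Forgetting the operators outside the image of `f` commutes with cones. This compares the Koszul
complex on the `x_i` inside `Q` with the one over `R`. -/
theorem reindex_koszul (f : τ → σ) (l : List τ) (C : Bicomplex σ K) :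
    (koszul (l.map f) C).reindex f = koszul l (C.reindex f) := by
  induction l generalizing C with
  | nil => rfl
  | cons s l ih => exact ih _

theorem hdim_koszul_map (f : τ → σ) (l : List τ) (C : Bicomplex σ K) (i j : ℤ) :
    (koszul (l.map f) C).hdim i j = (koszul l (C.reindex f)).hdim i j := by
  rw [← reindex_koszul]
  rfl

/-- A map that is bijective on the pieces with `j ≤ i + b`. -/
def Hom.BijectiveBelow {C D : Bicomplex σ K} (φ : Hom C D) (b : ℤ) : Prop :=
  (∀ i j, j ≤ i + b → ∀ a ∈ C.piece i j, φ.f a = 0 → a = 0) ∧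
  (∀ i j, j ≤ i + b → ∀ w ∈ D.piece i j, ∃ a ∈ C.piece i j, φ.f a = w)

/-- The region `j ≤ i + b` is stable under the shift by `(1, 1)` in the cone. -/
theorem Hom.BijectiveBelow.koszul (l : List σ) {C D : Bicomplex σ K} {φ : Hom C D} {b : ℤ}
    (h : φ.BijectiveBelow b) : (φ.koszul l).BijectiveBelow b := by
  induction l generalizing C D with
  | nil => exact h
  | cons s l ih =>
    refine ih (φ := φ.cone s) ⟨?_, ?_⟩
    · rintro i j hij ⟨a, b⟩ ⟨ha, hb⟩ h0
      obtain ⟨ha0, hb0⟩ := Prod.ext_iff.mp h0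
      exact Prod.ext (h.1 i j hij a ha ha0) (h.1 _ _ (by omega) b hb hb0)
    · rintro i j hij ⟨w, v⟩ ⟨hw, hv⟩
      obtain ⟨a, ha, haw⟩ := h.2 i j hij w hw
      obtain ⟨b, hb, hbv⟩ := h.2 _ _ (by omega) v hv
      exact ⟨(a, b), ⟨ha, hb⟩, Prod.ext haw hbv⟩

/-- The inequality is strict because lifting cycles needs injectivity in the target `(i - 1, j)` of
the differential. -/
theorem Hom.BijectiveBelow.hdim_eq {C D : Bicomplex σ K} {φ : Hom C D} {b : ℤ}
    (h : φ.BijectiveBelow b) {i j : ℤ} (hij : j < i + b) : C.hdim i j = D.hdim i j := by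
  refine Nonempty.elim (nonempty_subquotient_equiv φ.f (φ.mem_cycles i j) ?_ ?_ ?_)
    LinearEquiv.finrank_eq
  · rintro _ ⟨a, ha, rfl⟩
    exact ⟨φ.f a, φ.f_mem _ _ a ha, (φ.f_d a).symm⟩
  · rintro z ⟨hz, -⟩ ⟨w, hw, hwz⟩
    obtain ⟨u, hu, rfl⟩ := h.2 _ _ (by omega) w hw
    refine ⟨u, hu, ?_⟩
    rw [← φ.f_d, ← sub_eq_zero, ← map_sub] at hwz
    have := C.d_mem _ _ u hu
    rw [add_sub_cancel_right] at this
    exact sub_eq_zero.mp (h.1 i j hij.le _ (sub_mem this hz) hwz)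
  · rintro w ⟨hw, hw0 : D.d w = 0⟩
    obtain ⟨a, ha, rfl⟩ := h.2 i j hij.le w hw
    refine ⟨a, ⟨ha, ?_⟩, by simp⟩
    rw [← φ.f_d] at hw0
    exact h.1 _ _ (by omega) _ (C.d_mem _ _ a ha) hw0

/-- A map that is surjective on the pieces. -/
def Hom.SurjectiveOnPieces {C D : Bicomplex σ K} (φ : Hom C D) : Prop :=
  ∀ i j, ∀ w ∈ D.piece i j, ∃ a ∈ C.piece i j, φ.f a = w

theorem Hom.SurjectiveOnPieces.koszul (l : List σ) {C D : Bicomplex σ K} {φ : Hom C D}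
    (h : φ.SurjectiveOnPieces) : (φ.koszul l).SurjectiveOnPieces := by
  induction l generalizing C D with
  | nil => exact h
  | cons s l ih =>
    refine ih (φ := φ.cone s) ?_
    rintro i j ⟨w, v⟩ ⟨hw, hv⟩
    obtain ⟨a, ha, haw⟩ := h i j w hw
    obtain ⟨b, hb, hbv⟩ := h _ _ v hv
    exact ⟨(a, b), ⟨ha, hb⟩, Prod.ext haw hbv⟩

/-- The lowest homology is right exact. -/
theorem Hom.SurjectiveOnPieces.hdim_le {C D : Bicomplex σ K} {φ : Hom C D}
    (h : φ.SurjectiveOnPieces) (hC : C.LocallyFinite) {i j : ℤ} (h0 : C.piece (i - 1) j = ⊥) :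
    D.hdim i j ≤ C.hdim i j := by
  have := hC.homology i j
  let g : C.homology i j →ₗ[K] D.homology i j :=
    Submodule.mapQ _ _ (φ.f.restrict (φ.mem_cycles i j)) (by
      rintro z ⟨a, ha, haz⟩
      exact ⟨φ.f a, φ.f_mem _ _ a ha, by rw [← φ.f_d, haz]; rfl⟩)
  refine LinearMap.finrank_le_finrank_of_surjective (f := g) ?_
  intro w
  obtain ⟨⟨w, hw, hw0⟩, rfl⟩ := Submodule.Quotient.mk_surjective _ w
  obtain ⟨a, ha, rfl⟩ := h i j w hw
  have had : C.d a = 0 := by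
    have := C.d_mem _ _ a ha
    rwa [h0, Submodule.mem_bot] at this
  exact ⟨Submodule.Quotient.mk ⟨a, ha, had⟩, rfl⟩

end Bicomplex

/-! ### Quotient complexes -/

namespace Bicomplex

variable {σ : Type} {K : Type u} [Field K]

/-- The quotient by a subspace that is stable under the differential and the operators. -/
def quotient (C : Bicomplex σ K) (U : Submodule K C.carrier) (hd : U ≤ U.comap C.d)
    (hx : ∀ s, U ≤ U.comap (C.x s)) : Bicomplex σ K where
  carrier := C.carrier ⧸ U
  d := U.mapQ U C.d hd
  x s := U.mapQ U (C.x s) (hx s)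
  piece i j := (C.piece i j).map U.mkQ
  d_d a := by
    obtain ⟨a, rfl⟩ := U.mkQ_surjective a
    simp [C.d_d]
  x_d s a := by
    obtain ⟨a, rfl⟩ := U.mkQ_surjective a
    simp [C.x_d]
  x_x s t a := by
    obtain ⟨a, rfl⟩ := U.mkQ_surjective a
    simp [C.x_x s t]
  d_mem := by
    rintro i j _ ⟨a, ha, rfl⟩
    exact ⟨C.d a, C.d_mem _ _ a ha, rfl⟩
  x_mem := by
    rintro s i j _ ⟨a, ha, rfl⟩
    exact ⟨C.x s a, C.x_mem s _ _ a ha, rfl⟩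

variable {C : Bicomplex σ K}

/-- The projection onto a quotient. -/
def Hom.toQuotient (U : Submodule K C.carrier) (hd : U ≤ U.comap C.d)
    (hx : ∀ s, U ≤ U.comap (C.x s)) : Hom C (C.quotient U hd hx) where
  f := U.mkQ
  f_d _ := rfl
  f_x _ _ := rfl
  f_mem _ _ a ha := ⟨a, ha, rfl⟩

/-- The projection between two quotients. -/
def Hom.factor {U U' : Submodule K C.carrier} (h : U ≤ U') (hd : U ≤ U.comap C.d)
    (hx : ∀ s, U ≤ U.comap (C.x s)) (hd' : U' ≤ U'.comap C.d)
    (hx' : ∀ s, U' ≤ U'.comap (C.x s)) :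
    Hom (C.quotient U hd hx) (C.quotient U' hd' hx') where
  f := Submodule.factor h
  f_d a := by
    obtain ⟨a, rfl⟩ := U.mkQ_surjective a
    rfl
  f_x s a := by
    obtain ⟨a, rfl⟩ := U.mkQ_surjective a
    rfl
  f_mem := by
    rintro i j _ ⟨a, ha, rfl⟩
    exact ⟨a, ha, rfl⟩

end Bicomplex

/-! ### Graded modules and free resolutions as bigraded complexes -/

variable {σ ω : Type} {K : Type u} [Field K]

/-- A graded module as a complex concentrated in homological degree `0`. -/
def GrMod.toBicomplex (M : GrMod σ K) : Bicomplex σ K :=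
  letI := Module.compHom M.carrier (C : K →+* MvPolynomial σ K)
  { carrier := M.carrier
    d := 0
    x := fun s =>
      { toFun := fun m => (X s : MvPolynomial σ K) • m
        map_add' := smul_add _
        map_smul' := fun c m => smul_comm (X s : MvPolynomial σ K) (C c : MvPolynomial σ K) m }
    piece := fun i j =>
      { carrier := {m | m ∈ M.piece j ∧ (i ≠ 0 → m = 0)}
        add_mem' := fun {a b} ha hb =>
          ⟨add_mem ha.1 hb.1, fun h => by rw [ha.2 h, hb.2 h, add_zero]⟩
        zero_mem' := ⟨zero_mem _, fun _ => rfl⟩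
        smul_mem' := fun c m hm => by
          refine ⟨?_, fun h => by rw [hm.2 h, smul_zero]⟩
          have := M.smul_mem 0 j (C c) m (isHomogeneous_C _ _) hm.1
          rwa [Nat.cast_zero, zero_add] at this }
    d_d := fun _ => rfl
    x_d := fun s a => smul_zero _
    x_x := fun s t a => smul_comm (X s : MvPolynomial σ K) (X t : MvPolynomial σ K) (a : M.carrier)
    d_mem := fun _ _ _ _ => zero_mem _
    x_mem := fun s i j a ha => by
      refine ⟨?_, fun h => ?_⟩
      · have := M.smul_mem 1 j (X s) a (isHomogeneous_X _ _) ha.1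
        rwa [Nat.cast_one, add_comm] at this
      · change (X s : MvPolynomial σ K) • a = 0
        rw [ha.2 h, smul_zero] }

/-- A homogeneous element in the image of a graded map is the image of a homogeneous element. -/
theorem exists_homogeneous_preimage {N N' : Type*} [AddCommGroup N] [AddCommGroup N']
    {A : ℤ → AddSubgroup N} {B : ℤ → AddSubgroup N'} (hA : DirectSum.IsInternal A)
    (hB : DirectSum.IsInternal B) (φ : N →+ N') (hφ : ∀ k, ∀ x ∈ A k, φ x ∈ B k) {j : ℤ} (x : N)
    (hx : φ x ∈ B j) : ∃ y ∈ A j, φ y = φ x := by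
  classical
  obtain ⟨s, y, hy, rfl⟩ := exists_sum_of_isInternal hA x
  refine ⟨if j ∈ s then y j else 0, ?_, ?_⟩
  · split_ifs
    exacts [hy j, zero_mem _]
  -- The preimage is the component of degree `j`. The elements `φ (y k)`, corrected by `φ x` in
  -- degree `j`, are homogeneous with sum zero, so each of them vanishes.
  · have key := eq_zero_of_isInternal hB (insert j s)
      (fun k => φ (if k ∈ s then y k else 0) - if k = j then φ (∑ k ∈ s, y k) else 0)
      (fun k => ?_) ?_ j (Finset.mem_insert_self _ _)
    · simpa [sub_eq_zero] using key
    · refine sub_mem (hφ k _ ?_) ?_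
      · split_ifs
        exacts [hy k, zero_mem _]
      · split_ifs with h
        exacts [h ▸ hx, zero_mem _]
    · rw [Finset.sum_sub_distrib, Finset.sum_ite_eq', if_pos (Finset.mem_insert_self _ _),
        ← map_sum, sub_eq_zero, Finset.sum_ite_mem,
        Finset.inter_eq_right.mpr (Finset.subset_insert j s)]

namespace GradedFreeResolution

variable {M : GrMod σ K} (F : GradedFreeResolution M)

theorem d_comp_d (i : ℕ) (f : F.gen (i + 2) →₀ MvPolynomial σ K) : F.d i (F.d (i + 1) f) = 0 :=
  (F.exact_succ i _).mpr ⟨f, rfl⟩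

/-- The direct product of the free modules of a resolution, as a bigraded complex. -/
def toBicomplex : Bicomplex σ K where
  -- The full product does no harm, since an element of a piece has at most one nonzero component.
  carrier := ∀ i, F.gen i →₀ MvPolynomial σ K
  d := LinearMap.pi fun i => ((F.d i).restrictScalars K).comp (LinearMap.proj (i + 1))
  x s :=
    { toFun := fun f i => (X s : MvPolynomial σ K) • f i
      map_add' := fun f g => funext fun i => smul_add _ _ _
      map_smul' := fun c f => funext fun i => smul_comm (X s : MvPolynomial σ K) c (f i) }
  piece i j :=
    { carrier := {f | ∀ k : ℕ, f k ∈ freePiece σ K (F.deg k) j ∧ ((k : ℤ) ≠ i → f k = 0)}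
      add_mem' := fun {f g} hf hg k => ⟨add_mem (hf k).1 (hg k).1, fun h => by
        rw [Pi.add_apply, (hf k).2 h, (hg k).2 h, add_zero]⟩
      zero_mem' := fun k => ⟨zero_mem _, fun _ => rfl⟩
      smul_mem' := fun c f hf k => ⟨Submodule.smul_mem _ _ (hf k).1, fun h => by
        rw [Pi.smul_apply, (hf k).2 h, smul_zero]⟩ }
  d_d f := funext fun i => F.d_comp_d i _
  x_d s f := funext fun i => (map_smul (F.d i) _ _).symm
  x_x s t f := funext fun i => smul_comm _ _ _
  d_mem i j f hf k := by
    refine ⟨F.d_mem k j _ (hf (k + 1)).1, fun h => ?_⟩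
    change F.d k (f (k + 1)) = 0
    rw [(hf (k + 1)).2 (by push_cast; omega), map_zero]
  x_mem s i j f hf k := by
    refine ⟨?_, fun h => ?_⟩
    · have := freePiece_smul_mem (F.deg k) 1 j (X s) _ (isHomogeneous_X K s) (hf k).1
      rwa [Nat.cast_one, add_comm] at this
    · change (X s : MvPolynomial σ K) • f k = 0
      rw [(hf k).2 h, smul_zero]

theorem toBicomplex_d_apply (f : ∀ i, F.gen i →₀ MvPolynomial σ K) (k : ℕ) :
    F.toBicomplex.d f k = F.d k (f (k + 1)) := rfl

theorem single_mem_piece (i : ℕ) (j : ℤ) {g : F.gen i →₀ MvPolynomial σ K}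
    (hg : g ∈ freePiece σ K (F.deg i) j) : Pi.single i g ∈ F.toBicomplex.piece i j := by
  intro k
  by_cases hk : k = i
  · subst hk
    rw [Pi.single_eq_same]
    exact ⟨hg, fun h => absurd rfl h⟩
  · rw [Pi.single_eq_of_ne hk]
    exact ⟨zero_mem _, fun _ => rfl⟩

theorem eq_single_of_mem_piece {i : ℕ} {j : ℤ} {f : ∀ i, F.gen i →₀ MvPolynomial σ K}
    (hf : f ∈ F.toBicomplex.piece i j) : f = Pi.single i (f i) := by
  funext k
  by_cases hk : k = i
  · subst hk
    rw [Pi.single_eq_same]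
  · rw [Pi.single_eq_of_ne hk]
    exact (hf k).2 (by exact_mod_cast hk)

theorem d_single_succ (i : ℕ) (g : F.gen (i + 1) →₀ MvPolynomial σ K) :
    F.toBicomplex.d (Pi.single (i + 1) g) =
      (Pi.single i (F.d i g) : ∀ i, F.gen i →₀ MvPolynomial σ K) := by
  funext k
  rw [toBicomplex_d_apply]
  by_cases hk : k = i
  · subst hk
    rw [Pi.single_eq_same, Pi.single_eq_same]
  · rw [Pi.single_eq_of_ne hk, Pi.single_eq_of_ne (by omega), map_zero]

theorem d_single_zero (g : F.gen 0 →₀ MvPolynomial σ K) :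
    F.toBicomplex.d (Pi.single 0 g) = (0 : ∀ i, F.gen i →₀ MvPolynomial σ K) := by
  funext k
  rw [toBicomplex_d_apply, Pi.single_eq_of_ne (by omega), map_zero, Pi.zero_apply]

/-- The augmentation of a resolution as a map of complexes. -/
def augHom : Bicomplex.Hom F.toBicomplex M.toBicomplex :=
  letI := M.toBicomplex.module
  { f :=
      { toFun := fun f => F.aug (f 0)
        map_add' := fun f g => map_add F.aug _ _
        map_smul' := fun c f => by
          change F.aug (c • f 0) = (C c : MvPolynomial σ K) • F.aug (f 0)
          rw [← map_smul]
          congr 1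
          ext b : 1
          simp [MvPolynomial.smul_eq_C_mul] }
    f_d := fun f => (F.exact_zero _).mpr ⟨f 1, rfl⟩
    f_x := fun s f => map_smul F.aug _ _
    f_mem := fun i j f hf => by
      refine ⟨F.aug_mem j _ (hf 0).1, fun h => ?_⟩
      change F.aug (f 0) = 0
      rw [(hf 0).2 (by simpa using h.symm), map_zero] }

theorem exists_d_eq {i : ℕ} {j : ℤ} {f : F.gen i →₀ MvPolynomial σ K}
    (hf : f ∈ freePiece σ K (F.deg i) j) (h : ∃ g, F.d i g = f) :
    ∃ g ∈ freePiece σ K (F.deg (i + 1)) j, F.d i g = f := by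
  obtain ⟨g, rfl⟩ := h
  exact exists_homogeneous_preimage (free_isInternal (F.deg (i + 1))) (free_isInternal (F.deg i))
    (F.d i).toAddMonoidHom (F.d_mem i) g hf

/-- This is exactness of the resolution, once preimages are chosen homogeneous. -/
theorem isQuasi_augHom : F.augHom.IsQuasi where
  inj i j f hf hdf w hw hfw := by
    obtain hi | ⟨i, rfl⟩ : i < 0 ∨ ∃ n : ℕ, i = n := by
      rcases lt_or_ge i 0 with h | h
      exacts [.inl h, .inr ⟨i.toNat, (Int.toNat_of_nonneg h).symm⟩]
    · refine ⟨0, zero_mem _, ?_⟩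
      rw [map_zero]
      exact (funext fun k => (hf k).2 (by omega)).symm
    · have hfi : ∃ g, F.d i g = f i := by
        cases i with
        | zero => exact (F.exact_zero (f 0)).mp hfw
        | succ i => exact (F.exact_succ i (f (i + 1))).mp (congrFun hdf i)
      obtain ⟨g, hg, hgf⟩ := F.exists_d_eq (hf i).1 hfi
      refine ⟨Pi.single (i + 1) g, F.single_mem_piece (i + 1) j hg, ?_⟩
      rw [d_single_succ, hgf]
      exact (F.eq_single_of_mem_piece hf).symm
  surj i j w hw hdw := by
    by_cases hi : i = 0
    · subst hi
      obtain ⟨f, rfl⟩ := F.aug_surjective w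
      obtain ⟨g, hg, hgf⟩ := exists_homogeneous_preimage (free_isInternal (F.deg 0))
        M.isInternal F.aug.toAddMonoidHom F.aug_mem f hw.1
      refine ⟨Pi.single 0 g, F.single_mem_piece 0 j hg, F.d_single_zero g, 0, zero_mem _, ?_⟩
      rw [map_zero]
      change F.aug ((Pi.single 0 g : ∀ i, F.gen i →₀ MvPolynomial σ K) 0) = F.aug f + (0 : M.carrier)
      rw [Pi.single_eq_same, add_zero]
      exact hgf
    · refine ⟨0, zero_mem _, map_zero _, 0, zero_mem _, ?_⟩
      rw [map_zero, map_zero, add_zero]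
      exact (hw.2 hi).symm

/-- The elements of the free modules with coefficients in the ideal `(X s : s ∈ S)`. -/
def coeffsIn (S : Set σ) : Submodule K F.toBicomplex.carrier where
  carrier := {f | ∀ i (b : F.gen i), f i b ∈ Ideal.span (X '' S : Set (MvPolynomial σ K))}
  add_mem' hf hg i b := add_mem (hf i b) (hg i b)
  zero_mem' i b := zero_mem _
  smul_mem' c f hf i b := by
    have := Ideal.mul_mem_left _ (C c) (hf i b)
    rwa [← MvPolynomial.smul_eq_C_mul] at this

theorem mem_coeffsIn {S : Set σ} {f : ∀ i, F.gen i →₀ MvPolynomial σ K} :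
    f ∈ F.coeffsIn S ↔
      ∀ i (b : F.gen i), f i b ∈ Ideal.span (X '' S : Set (MvPolynomial σ K)) := Iff.rfl

/-- The ideal is monomial, so membership is tested on exponents; multiplication and division by a
variable then become shifts of exponents. -/
theorem mem_coeffsIn' {S : Set σ} {f : ∀ i, F.gen i →₀ MvPolynomial σ K} :
    f ∈ F.coeffsIn S ↔ ∀ i b e, coeff e (f i b) ≠ 0 → ∃ s ∈ S, e s ≠ 0 := by
  simp only [mem_coeffsIn, MvPolynomial.mem_ideal_span_X_image, mem_support_iff]

end GradedFreeResolution

/-- Linear maps send `I F` into `I F'`; this lets the differential descend modulo variables. -/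
theorem apply_mem_of_forall_mem {ι κ R : Type*} [CommRing R] (I : Ideal R)
    (φ : (ι →₀ R) →ₗ[R] (κ →₀ R)) (f : ι →₀ R) (hf : ∀ b, f b ∈ I) (c : κ) : φ f c ∈ I := by
  have h : φ f = f.sum fun b r => r • φ (Finsupp.single b 1) := by
    conv_lhs => rw [← f.sum_single]
    rw [map_finsuppSum]
    refine Finsupp.sum_congr fun b _ => ?_
    rw [← map_smul, Finsupp.smul_single, smul_eq_mul, mul_one]
  rw [h, Finsupp.sum, Finsupp.finsetSum_apply]
  exact sum_mem fun b _ => Ideal.mul_mem_right _ _ (hf b)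

/-! ### Dividing a resolution by variables -/

namespace GradedFreeResolution

variable {M : GrMod σ K} (F : GradedFreeResolution M)

/-- The complex `F / (X s : s ∈ S) F`. -/
def modVars (S : Set σ) : Bicomplex σ K :=
  F.toBicomplex.quotient (F.coeffsIn S)
    (fun _ hf i b => apply_mem_of_forall_mem _ (F.d i) _ (hf (i + 1)) b)
    (fun s _ hf i b => Ideal.mul_mem_left _ (X s) (hf i b))

theorem coeffsIn_mono {S T : Set σ} (h : S ⊆ T) : F.coeffsIn S ≤ F.coeffsIn T :=
  fun _ hf i b => Ideal.span_mono (Set.image_mono h) (hf i b)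

def modVarsHom {S T : Set σ} (h : S ⊆ T) : Bicomplex.Hom (F.modVars S) (F.modVars T) :=
  Bicomplex.Hom.factor (F.coeffsIn_mono h) _ _ _ _

def toModVarsEmpty : Bicomplex.Hom F.toBicomplex (F.modVars ∅) :=
  Bicomplex.Hom.toQuotient _ _ _

theorem isQuasi_toModVarsEmpty : F.toModVarsEmpty.IsQuasi := by
  apply Bicomplex.Hom.isQuasi_of_bijective
  · intro i j a _ ha
    have h1 := F.mem_coeffsIn'.mp ((Submodule.Quotient.mk_eq_zero _).mp ha)
    refine funext fun k => Finsupp.ext fun b => MvPolynomial.ext _ _ fun e => ?_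
    by_contra h
    simpa using h1 k b e h
  · rintro i j _ ⟨a, ha, rfl⟩
    exact ⟨a, ha, rfl⟩

theorem x_insert_eq_zero (S : Set σ) (t : σ) (a : (F.modVars S).carrier) :
    (F.modVarsHom (Set.subset_insert t S)).f ((F.modVars S).x t a) = 0 := by
  obtain ⟨a, rfl⟩ := (F.coeffsIn S).mkQ_surjective a
  refine (Submodule.Quotient.mk_eq_zero _).mpr fun i b => ?_
  exact Ideal.mul_mem_right _ _
    (Ideal.subset_span (Set.mem_image_of_mem X (Set.mem_insert t S)))

/-- For `t ∉ S`, the variable `X t` is a nonzerodivisor modulo the variables in `S`, and the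
cokernel of multiplication by it is the quotient by the variables in `insert t S`. -/
theorem isQuasi_modVars_cone {S : Set σ} {t : σ} (ht : t ∉ S) :
    ((F.modVarsHom (Set.subset_insert t S)).ofCone t (F.x_insert_eq_zero S t)).IsQuasi := by
  classical
  apply Bicomplex.Hom.isQuasi_ofCone
  · intro a ha
    obtain ⟨a, rfl⟩ := (F.coeffsIn S).mkQ_surjective a
    have h1 := F.mem_coeffsIn'.mp ((Submodule.Quotient.mk_eq_zero _).mp ha)
    refine (Submodule.Quotient.mk_eq_zero _).mpr (F.mem_coeffsIn'.mpr fun i b e he => ?_)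
    obtain ⟨s, hs, hse⟩ := h1 i b (Finsupp.single t 1 + e) (by
      change coeff _ (X t * a i b) ≠ 0
      rwa [coeff_X_mul])
    refine ⟨s, hs, ?_⟩
    rwa [Finsupp.add_apply, Finsupp.single_eq_of_ne (by rintro rfl; exact ht hs), zero_add] at hse
  · rintro i j _ ⟨a, ha, rfl⟩ h0
    have h1 := F.mem_coeffsIn'.mp ((Submodule.Quotient.mk_eq_zero _).mp h0)
    -- Divide every coefficient by `X t`, discarding the terms that do not contain it. By `h1` each
    -- discarded term contains a variable from `S`, so `X t * b` and `a` agree in the quotient.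
    let b : ∀ i, F.gen i →₀ MvPolynomial σ K := fun i =>
      (a i).mapRange (fun p => p.divMonomial (Finsupp.single t 1)) (zero_divMonomial _)
    have hb : ∀ k c e, coeff e (b k c) = coeff (Finsupp.single t 1 + e) (a k c) := fun k c e => by
      rw [Finsupp.mapRange_apply, coeff_divMonomial]
    refine ⟨(F.coeffsIn S).mkQ b, ⟨b, fun k => ⟨fun c e he => ?_, fun hk => ?_⟩, rfl⟩, ?_⟩
    · rw [hb] at he
      have := (ha k).1 c _ he
      rw [map_add, Finsupp.degree_single] at this
      push_cast at this
      omega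
    · ext c : 1
      rw [Finsupp.mapRange_apply, (ha k).2 hk, Finsupp.zero_apply, zero_divMonomial]
    · refine (Submodule.Quotient.eq _).mpr (F.mem_coeffsIn'.mpr fun k c e he => ?_)
      change coeff e (X t * b k c - a k c) ≠ 0 at he
      rw [coeff_sub, coeff_X_mul'] at he
      split_ifs at he with het
      · rw [hb, add_tsub_cancel_of_le, sub_self] at he
        · exact absurd rfl he
        · rw [Finsupp.single_le_iff]
          exact Nat.one_le_iff_ne_zero.mpr (Finsupp.mem_support_iff.mp het)
      · rw [zero_sub, neg_ne_zero] at he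
        obtain ⟨s, hs, hse⟩ := h1 k c e he
        refine ⟨s, hs.resolve_left ?_, hse⟩
        rintro rfl
        exact het (Finsupp.mem_support_iff.mpr hse)
  · rintro i j _ ⟨a, ha, rfl⟩
    exact ⟨_, ⟨a, ha, rfl⟩, rfl⟩

/-- Taking the Koszul complex of variables that are not in `S` amounts to dividing by them. -/
theorem nonempty_koszul_modVars (l : List σ) (hl : l.Nodup) (S : Set σ) (hS : ∀ s ∈ l, s ∉ S)
    (i j : ℤ) : Nonempty ((Bicomplex.koszul l (F.modVars S)).homology i j ≃ₗ[K]
      (F.modVars (S ∪ {s | s ∈ l})).homology i j) := by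
  induction l generalizing S with
  | nil =>
    have : S ∪ {s | s ∈ ([] : List σ)} = S := by simp
    rw [this]
    exact ⟨LinearEquiv.refl _ _⟩
  | cons t l ih =>
    rw [List.nodup_cons] at hl
    obtain ⟨e1⟩ := ((F.isQuasi_modVars_cone (hS t (by simp))).koszul l).nonempty_equiv i j
    obtain ⟨e2⟩ := ih hl.2 (insert t S) fun s hs => by
      rintro (rfl | h)
      exacts [hl.1 hs, hS s (by simp [hs]) h]
    have : S ∪ {s | s ∈ t :: l} = insert t S ∪ {s | s ∈ l} := by
      ext s
      simp only [List.mem_cons, Set.mem_union, Set.mem_ofPred_eq, Set.mem_insert_iff]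
      tauto
    rw [this]
    exact ⟨e1.trans e2⟩

end GradedFreeResolution

/-! ### The identification of `F/(X)F` with `F ⊗ K`, and Tor as Koszul homology -/

section FreeTensor

variable {ι : Type u}

/-- The map `f ↦ f ⊗ 1` from a free module `F` to `F ⊗ K`. -/
def toFreeTensor (σ : Type) (K : Type u) [Field K] (ι : Type u) :
    (ι →₀ MvPolynomial σ K) →ₗ[K] FreeTensor σ K ι :=
  ((TensorProduct.mk (MvPolynomial σ K) (ι →₀ MvPolynomial σ K)
    (MvPolynomial σ K ⧸ irrelevant σ K)).flip 1).restrictScalars K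

theorem toFreeTensor_apply (f : ι →₀ MvPolynomial σ K) : toFreeTensor σ K ι f = f ⊗ₜ 1 := rfl

theorem mem_irrelevant_iff {p : MvPolynomial σ K} : p ∈ irrelevant σ K ↔ coeff 0 p = 0 := by
  rw [irrelevant, ← Set.image_univ, mem_ideal_span_X_image]
  simp only [Set.mem_univ, true_and, mem_support_iff]
  constructor
  · intro h
    by_contra h0
    simpa using h 0 h0
  · intro h e he
    by_contra! h0
    rw [show e = 0 from Finsupp.ext h0] at he
    exact he h

theorem mk_eq_smul_one (p : MvPolynomial σ K) : Ideal.Quotient.mk (irrelevant σ K) p =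
    p • (1 : MvPolynomial σ K ⧸ irrelevant σ K) := by
  have := Submodule.Quotient.mk_smul (irrelevant σ K) p (1 : MvPolynomial σ K)
  rwa [smul_eq_mul, mul_one] at this

theorem tmul_mk (f : ι →₀ MvPolynomial σ K) (p : MvPolynomial σ K) :
    (f ⊗ₜ (Ideal.Quotient.mk (irrelevant σ K) p) : FreeTensor σ K ι) =
      toFreeTensor σ K ι (p • f) := by
  rw [toFreeTensor_apply, TensorProduct.smul_tmul]
  congr 1
  exact mk_eq_smul_one p

/-- The coordinate maps `F ⊗ K → K` detect the coefficients modulo the irrelevant ideal; conversely,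
such coefficients can be moved across the tensor sign, where they vanish. -/
theorem toFreeTensor_eq_zero_iff (f : ι →₀ MvPolynomial σ K) :
    toFreeTensor σ K ι f = 0 ↔ ∀ b, f b ∈ irrelevant σ K := by
  constructor
  · intro h b
    let φ : (ι →₀ MvPolynomial σ K) ⊗[MvPolynomial σ K] (MvPolynomial σ K ⧸ irrelevant σ K)
        →ₗ[MvPolynomial σ K] (MvPolynomial σ K ⧸ irrelevant σ K) :=
      TensorProduct.lift ((LinearMap.lsmul _ _).comp (Finsupp.lapply b))
    have h1 : φ (f ⊗ₜ 1) = 0 := (congrArg φ h).trans (map_zero φ)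
    rw [TensorProduct.lift.tmul] at h1
    rw [← Ideal.Quotient.eq_zero_iff_mem, ← h1]
    change _ = f b • (1 : MvPolynomial σ K ⧸ irrelevant σ K)
    exact mk_eq_smul_one (f b)
  · intro h
    rw [← f.sum_single, Finsupp.sum, map_sum]
    refine Finset.sum_eq_zero fun b _ => ?_
    have := tmul_mk (Finsupp.single b 1) (f b)
    rw [Finsupp.smul_single, smul_eq_mul, mul_one] at this
    rw [← this, Ideal.Quotient.eq_zero_iff_mem.mpr (h b)]
    exact TensorProduct.tmul_zero _ _

end FreeTensor

namespace GradedFreeResolution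

variable {M : GrMod σ K} (F : GradedFreeResolution M)

/-- Every class in the residue field is that of a constant, so `f ⊗ c = (c f) ⊗ 1` with `c f` of the
same degree. -/
theorem mem_tensorPiece {i : ℕ} {j : ℤ} {z : FreeTensor σ K (F.gen i)} :
    z ∈ F.tensorPiece i j ↔ ∃ f ∈ freePiece σ K (F.deg i) j, toFreeTensor σ K _ f = z := by
  constructor
  · intro hz
    change z ∈ (freePiece σ K (F.deg i) j).map (toFreeTensor σ K (F.gen i))
    refine Submodule.span_le.mpr ?_ hz
    rintro _ ⟨f, hf, c, rfl⟩
    obtain ⟨p, rfl⟩ := Ideal.Quotient.mk_surjective c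
    have h1 : Ideal.Quotient.mk (irrelevant σ K) p =
        Ideal.Quotient.mk (irrelevant σ K) (C (coeff 0 p)) := by
      rw [Ideal.Quotient.eq, mem_irrelevant_iff]
      simp
    refine ⟨coeff 0 p • f, Submodule.smul_mem _ _ hf, ?_⟩
    rw [h1]
    refine Eq.trans ?_ (tmul_mk f (C (coeff 0 p))).symm
    congr 1
    ext b : 1
    simp [MvPolynomial.smul_eq_C_mul]
  · rintro ⟨f, hf, rfl⟩
    exact Submodule.subset_span ⟨f, hf, 1, rfl⟩

theorem cycles_le_tensorPiece (i : ℕ) (j : ℤ) : F.cycles i j ≤ F.tensorPiece i j := by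
  cases i with
  | zero => exact le_rfl
  | succ i => exact inf_le_left

theorem mem_coeffsIn_univ {f : ∀ i, F.gen i →₀ MvPolynomial σ K} :
    f ∈ F.coeffsIn Set.univ ↔ ∀ i, toFreeTensor σ K _ (f i) = 0 := by
  simp only [mem_coeffsIn, toFreeTensor_eq_zero_iff, irrelevant, Set.image_univ]

/-- The isomorphism is induced by the `i`-th coordinate. The case `i = 0` is separate because
`cycles` imposes no kernel condition there; correspondingly, `d` kills everything in homological
degree `0`. -/
theorem nonempty_modVars_univ_equiv (i : ℕ) (j : ℤ) :
    Nonempty ((F.modVars Set.univ).homology i j ≃ₗ[K] F.homology i j) := by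
  refine nonempty_subquotient_equiv ((F.coeffsIn Set.univ).liftQ
    ((toFreeTensor σ K (F.gen i)).comp (LinearMap.proj i))
    fun f hf => F.mem_coeffsIn_univ.mp hf i) ?_ ?_ ?_ ?_
  · rintro _ ⟨⟨f, hf, rfl⟩, hf0⟩
    have h0 := F.mem_coeffsIn_univ.mp ((Submodule.Quotient.mk_eq_zero _).mp hf0)
    have h1 : toFreeTensor σ K _ (f i) ∈ F.tensorPiece i j :=
      F.mem_tensorPiece.mpr ⟨f i, (hf i).1, rfl⟩
    cases i with
    | zero => exact h1
    | succ i => exact ⟨h1, h0 i⟩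
  · rintro _ ⟨_, ⟨f, hf, rfl⟩, rfl⟩
    exact ⟨_, F.mem_tensorPiece.mpr ⟨f (i + 1), (hf (i + 1)).1, rfl⟩, rfl⟩
  · rintro _ ⟨⟨f, hf, rfl⟩, -⟩ ⟨t, ht, htf⟩
    obtain ⟨g, hg, rfl⟩ := F.mem_tensorPiece.mp ht
    refine ⟨_, ⟨Pi.single (i + 1) g, F.single_mem_piece (i + 1) j hg, rfl⟩, ?_⟩
    refine (Submodule.Quotient.eq _).mpr (F.mem_coeffsIn_univ.mpr fun k => ?_)
    rw [d_single_succ]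
    by_cases hk : k = i
    · subst hk
      change toFreeTensor σ K _ ((Pi.single k (F.d k g) : ∀ i, F.gen i →₀ MvPolynomial σ K) k
        - f k) = 0
      rw [Pi.single_eq_same, map_sub, sub_eq_zero]
      exact htf
    · change toFreeTensor σ K _ ((Pi.single i (F.d i g) : ∀ i, F.gen i →₀ MvPolynomial σ K) k
        - f k) = 0
      rw [Pi.single_eq_of_ne hk, (hf k).2 (by exact_mod_cast hk), sub_zero, map_zero]
  · intro w hw
    obtain ⟨g, hg, rfl⟩ := F.mem_tensorPiece.mp (F.cycles_le_tensorPiece i j hw)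
    refine ⟨_, ⟨⟨Pi.single i g, F.single_mem_piece i j hg, rfl⟩, ?_⟩, ?_⟩
    · refine (Submodule.Quotient.mk_eq_zero _).mpr (F.mem_coeffsIn_univ.mpr ?_)
      cases i with
      | zero =>
        rw [d_single_zero]
        exact fun _ => map_zero _
      | succ i =>
        rw [d_single_succ]
        intro k
        by_cases hk : k = i
        · subst hk
          rw [Pi.single_eq_same]
          exact hw.2
        · rw [Pi.single_eq_of_ne hk, map_zero]
    · change toFreeTensor σ K _ ((Pi.single i g : ∀ i, F.gen i →₀ MvPolynomial σ K) i) - _ ∈ _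
      rw [Pi.single_eq_same, sub_self]
      exact zero_mem _

/-- Balancing of Tor: the Koszul complex of `F` maps by quasi-isomorphisms to that of `M` and,
through `modVars ∅`, to `F` modulo all variables. -/
theorem nonempty_koszul_equiv_modVars (l : List σ) (hl : l.Nodup) (hl' : ∀ s, s ∈ l) (i j : ℤ) :
    Nonempty ((Bicomplex.koszul l M.toBicomplex).homology i j ≃ₗ[K]
      (F.modVars Set.univ).homology i j) := by
  obtain ⟨e1⟩ := (F.isQuasi_augHom.koszul l).nonempty_equiv i j
  obtain ⟨e2⟩ := (F.isQuasi_toModVarsEmpty.koszul l).nonempty_equiv i j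
  obtain ⟨e3⟩ := F.nonempty_koszul_modVars l hl ∅ (by simp) i j
  have : ∅ ∪ {s | s ∈ l} = Set.univ := by
    ext s
    simp [hl' s]
  rw [this] at e3
  exact ⟨e1.symm.trans (e2.trans e3)⟩

/-- `Tor`, computed from any graded free resolution, is Koszul homology. -/
theorem nonempty_homology_equiv (l : List σ) (hl : l.Nodup) (hl' : ∀ s, s ∈ l) (i : ℕ) (j : ℤ) :
    Nonempty (F.homology i j ≃ₗ[K] (Bicomplex.koszul l M.toBicomplex).homology i j) := by
  obtain ⟨e1⟩ := F.nonempty_koszul_equiv_modVars l hl hl' i j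
  obtain ⟨e2⟩ := F.nonempty_modVars_univ_equiv i j
  exact ⟨e2.symm.trans e1.symm⟩

end GradedFreeResolution

theorem betti_eq_hdim (M : GrMod σ K) (l : List σ) (hl : l.Nodup) (hl' : ∀ s, s ∈ l)
    (i : ℕ) (j : ℤ) : betti M i j = (Bicomplex.koszul l M.toBicomplex).hdim i j :=
  ((Classical.choice (GradedFreeResolution.nonempty M)).nonempty_homology_equiv l hl hl' i j).elim
    LinearEquiv.finrank_eq

theorem finite_gradedTor (M : GrMod σ K) [Finite σ] (hM : M.toBicomplex.LocallyFinite)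
    (i : ℕ) (j : ℤ) : Module.Finite K (gradedTor M i j) := by
  have := Fintype.ofFinite σ
  obtain ⟨e⟩ := (Classical.choice (GradedFreeResolution.nonempty M)).nonempty_homology_equiv
    Finset.univ.toList (Finset.nodup_toList _) (by simp) i j
  have := (hM.koszul Finset.univ.toList).homology i j
  exact Module.Finite.equiv e.symm

/-! ### Generating series and binomial sums -/

section Numerics

/-- The power series `∑ g i j t^i s^j`. -/
def seriesOf (g : ℤ → ℤ → ℤ) : MvPowerSeries (Fin 2) ℤ := fun e => g (e 0) (e 1)

theorem coeff_seriesOf (g : ℤ → ℤ → ℤ) (e : Fin 2 →₀ ℕ) :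
    MvPowerSeries.coeff e (seriesOf g) = g (e 0) (e 1) := rfl

/-- The vanishing at negative indices accounts for the coefficients with `e 0 = 0` or `e 1 = 0`, to
which `st` contributes nothing. -/
theorem seriesOf_mul (g : ℤ → ℤ → ℤ) (hg : ∀ i j, i < 0 ∨ j < 0 → g i j = 0) :
    seriesOf g * (1 + sVar * tVar) = seriesOf (fun i j => g i j + g (i - 1) (j - 1)) := by
  classical
  ext e
  rw [mul_add, mul_one, map_add, sVar, tVar, MvPowerSeries.X, MvPowerSeries.X,
    MvPowerSeries.monomial_mul_monomial, MvPowerSeries.coeff_mul_monomial]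
  simp only [coeff_seriesOf, mul_one]
  congr 1
  split_ifs with h
  · have h0 := h 0
    have h1 := h 1
    simp at h0 h1 ⊢
    rw [Nat.cast_sub h0, Nat.cast_sub h1]
    rfl
  · refine (hg _ _ ?_).symm
    by_contra! h'
    apply h
    intro k
    fin_cases k <;> simp <;> omega

theorem seriesOf_mul_pow (n : ℕ) (g : ℤ → ℤ → ℤ) (hg : ∀ i j, i < 0 ∨ j < 0 → g i j = 0) :
    seriesOf g * (1 + sVar * tVar) ^ n =
      seriesOf (fun i j => ∑ k ∈ Finset.range (n + 1), (n.choose k : ℤ) * g (i - k) (j - k)) := by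
  induction n generalizing g with
  | zero => simp
  | succ n ih =>
    rw [pow_succ', ← mul_assoc, seriesOf_mul g hg, ih]
    · simp only [sum_choose_succ_mul]
    · intro i j h
      rw [hg i j h, hg _ _ (by omega), add_zero]

theorem one_eq_seriesOf :
    (1 : MvPowerSeries (Fin 2) ℤ) = seriesOf fun i j => if i = 0 ∧ j = 0 then 1 else 0 := by
  classical
  ext e
  rw [MvPowerSeries.coeff_one, coeff_seriesOf]
  refine if_congr ?_ rfl rfl
  rw [Finsupp.ext_iff, Fin.forall_fin_two]
  simp

variable {m n : ℕ} {g : ℤ → ℤ → ℕ}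

/-- Only `[i - m]_+ ≤ k < i` contributes: smaller `k` give rows above `m`, larger `k` give negative
rows, and `k = i` gives row `0` in degree `j - i ≠ 0`. Then substitute `k = [i - m]_+ + l`;
truncated subtraction is the positive part. -/
theorem sum_choose_offDiag (hneg : ∀ i j, i < 0 ∨ (m : ℤ) < i ∨ j < i → g i j = 0)
    (hdiag : ∀ i j, i = j ∨ i = 0 → g i j = if i = 0 ∧ j = 0 then 1 else 0)
    (i : ℕ) (j : ℤ) (hij : j ≠ i) :
    ∑ k ∈ Finset.range (n + 1), n.choose k * g (i - k) (j - k) =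
      ∑ l ∈ Finset.range (min i m), n.choose ((i - m) + l) *
        g (min i m - l : ℕ) (j - (l : ℤ) - ((i - m : ℕ) : ℤ)) := by
  -- Enlarge the range until it contains the interval; the new binomial coefficients are zero.
  have h1 : ∑ k ∈ Finset.range (n + 1), n.choose k * g (i - k) (j - k) =
      ∑ k ∈ Finset.range (n + 1 + i), n.choose k * g (i - k) (j - k) := by
    refine Finset.sum_subset (Finset.range_subset_range.mpr (by omega)) fun k _ hk => ?_
    rw [Nat.choose_eq_zero_of_lt (by simpa using hk), zero_mul]
  have h2 : ∑ k ∈ Finset.Ico (i - m) i, n.choose k * g (i - k) (j - k) =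
      ∑ k ∈ Finset.range (n + 1 + i), n.choose k * g (i - k) (j - k) := by
    refine Finset.sum_subset (fun k hk => ?_) fun k _ hk => ?_
    · rw [Finset.mem_Ico] at hk
      rw [Finset.mem_range]
      omega
    · rw [Finset.mem_Ico] at hk
      by_cases hki : k = i
      · subst hki
        rw [hdiag _ _ (.inr (sub_self _)), if_neg (by omega), mul_zero]
      · rw [hneg _ _ (by omega), mul_zero]
  rw [h1, ← h2, Finset.sum_Ico_eq_sum_range]
  have h3 : i - (i - m) = min i m := by omega
  rw [h3]
  refine Finset.sum_congr rfl fun l hl => ?_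
  rw [Finset.mem_range] at hl
  congr 2
  · omega
  · push_cast
    ring

theorem sum_choose_diag
    (hdiag : ∀ i j, i = j ∨ i = 0 → g i j = if i = 0 ∧ j = 0 then 1 else 0) (i : ℕ) :
    ∑ k ∈ Finset.range (n + 1), n.choose k * g (i - k) (i - k) = n.choose i := by
  have h : ∀ k ∈ Finset.range (n + 1), n.choose k * g (i - k) (i - k) =
      if k = i then n.choose k else 0 := by
    intro k _
    rw [hdiag _ _ (.inl rfl)]
    by_cases hk : k = i
    · simp [hk]
    · rw [if_neg (by omega), if_neg hk, mul_zero]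
  rw [Finset.sum_congr rfl h, Finset.sum_ite_eq']
  split_ifs with hi
  · rfl
  · rw [Nat.choose_eq_zero_of_lt (by simpa using hi)]

/-- Multiplication by `1 + st` preserves `j - i`, so taking the strict part commutes with it; the
strict part of the original series is that series minus `1`. -/
theorem strictPart_seriesOf (hneg : ∀ i j, i < 0 ∨ (m : ℤ) < i ∨ j < i → g i j = 0)
    (hdiag : ∀ i j, i = j ∨ i = 0 → g i j = if i = 0 ∧ j = 0 then 1 else 0) :
    strictPart (seriesOf fun i j => ∑ k ∈ Finset.range (n + 1),
      (n.choose k : ℤ) * g (i - k) (j - k)) =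
      (seriesOf (fun i j => g i j) - 1) * (1 + sVar * tVar) ^ n := by
  have h1 : seriesOf (fun i j => g i j) - 1 = seriesOf fun i j => if i < j then g i j else 0 := by
    rw [one_eq_seriesOf]
    ext e
    rw [map_sub, coeff_seriesOf, coeff_seriesOf, coeff_seriesOf]
    rcases lt_trichotomy (e 0 : ℤ) (e 1) with h | h | h
    · rw [if_neg (by omega), if_pos h, sub_zero]
    · rw [if_neg h.not_lt, hdiag _ _ (.inl h)]
      push_cast
      exact sub_self _
    · rw [if_neg (by omega), if_neg (by omega), hneg _ _ (by omega), Nat.cast_zero, sub_zero]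
  rw [h1, seriesOf_mul_pow]
  · ext e
    change (if e 0 < e 1 then _ else _) = _
    rw [coeff_seriesOf, coeff_seriesOf]
    split_ifs with h
    · exact Finset.sum_congr rfl fun k _ => by rw [if_pos (by omega)]
    · exact (Finset.sum_eq_zero fun k _ => by rw [if_neg (by omega), mul_zero]).symm
  · intro i j h
    split_ifs with hij
    · rw [hneg _ _ (by omega), Nat.cast_zero]
    · rfl

end Numerics

/-! ### Additional variables that act as zero -/

section Restrict

variable (M : GrMod σ K) (π : MvPolynomial ω K →ₐ[K] MvPolynomial σ K)
  (hπ : ∀ (k : ℕ) (p : MvPolynomial ω K), p.IsHomogeneous k → (π p).IsHomogeneous k)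

/-- The identity of a module, as a map from its restriction of scalars. -/
def restrictHom (f : σ → ω) (hf : ∀ s, π (X (f s)) = X s) :
    Bicomplex.Hom ((M.restrict π hπ).toBicomplex.reindex f) M.toBicomplex :=
  letI := M.toBicomplex.module
  letI := (M.restrict π hπ).toBicomplex.module
  { f :=
      { toFun := fun a => (a : M.carrier)
        map_add' := fun _ _ => rfl
        map_smul' := fun c (a : M.carrier) => by
          change π (C c) • a = (C c : MvPolynomial σ K) • a
          rw [← algebraMap_eq, ← algebraMap_eq, AlgHom.commutes] }
    f_d := fun _ => rfl
    f_x := fun s (a : M.carrier) => by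
      change π (X (f s)) • a = (X s : MvPolynomial σ K) • a
      rw [hf]
    f_mem := fun _ _ _ ha => ha }

theorem isQuasi_restrictHom (f : σ → ω) (hf : ∀ s, π (X (f s)) = X s) :
    (restrictHom M π hπ f hf).IsQuasi :=
  Bicomplex.Hom.isQuasi_of_bijective _ (fun _ _ _ _ h => h) fun _ _ w hw => ⟨w, hw, rfl⟩

theorem locallyFinite_restrict (f : σ → ω) (hf : ∀ s, π (X (f s)) = X s)
    (hM : M.toBicomplex.LocallyFinite) : (M.restrict π hπ).toBicomplex.LocallyFinite := by
  intro i j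
  have := hM i j
  exact Module.Finite.of_injective ((restrictHom M π hπ f hf).f.restrict
    ((restrictHom M π hπ f hf).f_mem i j)) fun a b h => Subtype.ext (congrArg Subtype.val h)

/-- The Betti numbers of a module over a polynomial ring with additional variables that act as
zero. -/
theorem betti_restrict (f : σ → ω) (hf : ∀ s, π (X (f s)) = X s)
    (hM : M.toBicomplex.LocallyFinite) (l : List σ) (l' : List ω) (hl' : ∀ s ∈ l', π (X s) = 0)
    (hnodup : (l.map f ++ l').Nodup) (hall : ∀ s, s ∈ l.map f ++ l') (i : ℕ) (j : ℤ) :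
    betti (M.restrict π hπ) i j = ∑ k ∈ Finset.range (l'.length + 1),
      l'.length.choose k * (Bicomplex.koszul l M.toBicomplex).hdim (i - k) (j - k) := by
  have hM' := locallyFinite_restrict M π hπ f hf hM
  -- The old variables come first in the list, so the zero operators are applied to the complete
  -- Koszul complex of `M`.
  rw [betti_eq_hdim _ _ hnodup hall, Bicomplex.koszul_append,
    Bicomplex.hdim_koszul_of_zero l' (hM'.koszul _)]
  · refine Finset.sum_congr rfl fun k _ => ?_
    rw [Bicomplex.hdim_koszul_map, ((isQuasi_restrictHom M π hπ f hf).koszul l).hdim_eq]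
  · intro s hs
    apply Bicomplex.koszul_x_eq_zero
    refine LinearMap.ext fun (a : M.carrier) => ?_
    change π (X s) • a = (0 : M.carrier)
    rw [hl' s hs, zero_smul]

end Restrict

/-! ### Koszul homology of `P/𝔞`: vanishing region and diagonal -/

section Quotient

variable (𝔞 : Ideal (MvPolynomial σ K)) (h𝔞 : 𝔞.IsHomogeneous (homogeneousSubmodule σ K))

theorem eq_zero_of_mem_polyPiece {j : ℤ} (hj : j < 0) {p : MvPolynomial σ K}
    (hp : p ∈ polyPiece σ K j) : p = 0 := by
  ext e
  by_contra h
  have := hp e h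
  omega

/-- The bounds have the shape of the hypothesis of `koszul_piece_eq_bot` with `a = b = 0`. -/
theorem quotientMod_piece_eq_bot (i j : ℤ) (h : i < 0 ∨ 0 < i ∨ j < i + 0) :
    (quotientMod 𝔞 h𝔞).toBicomplex.piece i j = ⊥ := by
  rw [eq_bot_iff]
  rintro a ⟨⟨p, hp, rfl⟩, hi⟩
  by_cases h0 : i = 0
  · rw [eq_zero_of_mem_polyPiece (by omega) hp]
    exact map_zero _
  · exact hi h0

theorem locallyFinite_quotientMod [Finite σ] :
    (quotientMod 𝔞 h𝔞).toBicomplex.LocallyFinite := by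
  intro i j
  let := (quotientMod 𝔞 h𝔞).toBicomplex.module
  let φ : MvPolynomial σ K →ₗ[K] (quotientMod 𝔞 h𝔞).toBicomplex.carrier :=
    { toFun := fun p => Ideal.Quotient.mk 𝔞 p
      map_add' := map_add _
      map_smul' := fun c p => by
        rw [smul_eq_C_mul, map_mul]
        rfl }
  have hfin : {e : σ →₀ ℕ | (e.degree : ℤ) = j}.Finite := by
    refine (Finsupp.finite_of_degree_le j.toNat).subset ?_
    intro e he
    simp only [Set.mem_ofPred_eq] at he ⊢
    omega
  have := Module.Finite.span_of_finite K
    (hfin.image fun e => φ (monomial e 1))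
  refine Submodule.finiteDimensional_of_le
    (S₂ := Submodule.span K ((fun e => φ (monomial e 1)) '' {e | (e.degree : ℤ) = j})) ?_
  rintro a ⟨⟨p, hp, rfl⟩, -⟩
  change φ p ∈ _
  rw [p.as_sum, map_sum]
  refine sum_mem fun e he => ?_
  have : monomial e (coeff e p) = coeff e p • monomial e (1 : K) := by
    rw [smul_monomial, smul_eq_mul, mul_one]
  rw [this, map_smul]
  exact Submodule.smul_mem _ _
    (Submodule.subset_span ⟨e, hp e (mem_support_iff.mp he), rfl⟩)

/-- The projection from the polynomial ring onto `P ⧸ 𝔞`. -/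
def quotientHom : Bicomplex.Hom (quotientMod (⊥ : Ideal (MvPolynomial σ K))
    (HomogeneousIdeal.isHomogeneous ⊥)).toBicomplex (quotientMod 𝔞 h𝔞).toBicomplex :=
  letI := (quotientMod 𝔞 h𝔞).toBicomplex.module
  letI := (quotientMod (⊥ : Ideal (MvPolynomial σ K))
    (HomogeneousIdeal.isHomogeneous ⊥)).toBicomplex.module
  { f :=
      { toFun := fun a => Submodule.factor (bot_le : ⊥ ≤ 𝔞) a
        map_add' := map_add _
        map_smul' := fun c (a : MvPolynomial σ K ⧸ ⊥) =>
          map_smul (Submodule.factor (bot_le : ⊥ ≤ 𝔞)) (C c) a }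
    f_d := fun _ => map_zero (Submodule.factor (bot_le : ⊥ ≤ 𝔞))
    f_x := fun s (a : MvPolynomial σ K ⧸ ⊥) =>
      map_smul (Submodule.factor (bot_le : ⊥ ≤ 𝔞)) (X s) a
    f_mem := by
      rintro i j _ ⟨⟨p, hp, rfl⟩, hi⟩
      refine ⟨⟨p, hp, rfl⟩, fun h => ?_⟩
      rw [hi h]
      exact map_zero (Submodule.factor (bot_le : ⊥ ≤ 𝔞)) }

theorem surjectiveOnPieces_quotientHom : (quotientHom 𝔞 h𝔞).SurjectiveOnPieces := by
  rintro i j _ ⟨⟨p, hp, rfl⟩, hi⟩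
  by_cases h0 : i = 0
  · exact ⟨Ideal.Quotient.mk ⊥ p, ⟨⟨p, hp, rfl⟩, fun h => absurd h0 h⟩, rfl⟩
  · exact ⟨0, zero_mem _, (map_zero _).trans (hi h0).symm⟩

/-- Only `i = 0` matters, hence `j ≤ 1`. Properness excludes nonzero constants from `𝔞`, and
`h𝔞_lin` excludes nonzero linear forms. -/
theorem bijectiveBelow_quotientHom (h𝔞_top : 𝔞 ≠ ⊤)
    (h𝔞_lin : ∀ p ∈ 𝔞, p.IsHomogeneous 1 → p = 0) : (quotientHom 𝔞 h𝔞).BijectiveBelow 1 := by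
  refine ⟨?_, fun i j _ => surjectiveOnPieces_quotientHom 𝔞 h𝔞 i j⟩
  rintro i j hij _ ⟨⟨p, hp, rfl⟩, hi⟩ h0
  by_cases hi0 : i = 0
  · have hpa : p ∈ 𝔞 := Ideal.Quotient.eq_zero_iff_mem.mp h0
    suffices h : p = 0 by
      rw [h]
      exact map_zero _
    obtain hj | rfl | rfl : j < 0 ∨ j = 0 ∨ j = 1 := by omega
    · exact eq_zero_of_mem_polyPiece hj hp
    · have hpC : p = C (coeff 0 p) := by
        ext e
        classical
        rw [coeff_C]
        split_ifs with he
        · rw [he]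
        · by_contra h
          have := hp e h
          rw [Nat.cast_eq_zero, Finsupp.degree_eq_zero_iff] at this
          exact he this.symm
      by_contra hne
      have hc : coeff 0 p ≠ 0 := fun h => hne (by rw [hpC, h, C_0])
      rw [hpC] at hpa
      exact h𝔞_top (Ideal.eq_top_of_isUnit_mem _ hpa ((isUnit_iff_ne_zero.mpr hc).map C))
    · refine h𝔞_lin p hpa fun e he => ?_
      have h1 := hp e he
      have h2 : e.degree = 1 := by exact_mod_cast h1
      exact (DFunLike.congr_fun Finsupp.degree_eq_weight_one e).symm.trans h2
  · exact hi hi0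

/-- The generators of the trivial resolution of a polynomial ring. -/
def trivialGen : ℕ → Type u
  | 0 => PUnit
  | _ + 1 => PEmpty

instance (i : ℕ) : IsEmpty (trivialGen.{u} (i + 1)) := inferInstanceAs (IsEmpty PEmpty)

/-- The trivial resolution of a polynomial ring, as a module over itself. -/
def trivialResolution (σ : Type) (K : Type u) [Field K] :
    GradedFreeResolution (quotientMod (⊥ : Ideal (MvPolynomial σ K))
      (HomogeneousIdeal.isHomogeneous ⊥)) where
  gen := trivialGen
  deg _ _ := 0
  d _ := 0
  aug := (Submodule.mkQ (⊥ : Ideal (MvPolynomial σ K))).comp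
    (Finsupp.lapply (PUnit.unit : trivialGen.{u} 0))
  d_mem _ _ _ _ := zero_mem _
  aug_mem j f hf := ⟨f PUnit.unit, fun e he => by simpa using hf PUnit.unit e he, rfl⟩
  aug_surjective a := by
    obtain ⟨p, rfl⟩ := Ideal.Quotient.mk_surjective a
    exact ⟨Finsupp.single PUnit.unit p, congrArg _ (Finsupp.single_eq_same)⟩
  exact_zero f := by
    constructor
    · intro h
      refine ⟨0, Finsupp.ext fun b => ?_⟩
      have h1 := (Submodule.Quotient.mk_eq_zero _).mp h
      exact ((Submodule.mem_bot _).mp h1).symm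
    · rintro ⟨_, rfl⟩
      exact map_zero _
  exact_succ i f := ⟨fun _ => ⟨0, Subsingleton.elim _ _⟩, fun _ => rfl⟩

theorem trivialResolution_piece_eq_bot {i j : ℤ} (h : ¬(i = 0 ∧ j = 0)) :
    ((trivialResolution σ K).modVars Set.univ).piece i j = ⊥ := by
  rw [eq_bot_iff]
  rintro _ ⟨f, hf, rfl⟩
  refine (Submodule.Quotient.mk_eq_zero _).mpr
    ((trivialResolution σ K).mem_coeffsIn'.mpr fun k b e he => ?_)
  by_contra! h0
  have he0 : e = 0 := Finsupp.ext fun s => h0 s (Set.mem_univ s)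
  cases k with
  | zero =>
    have h1 := (hf 0).1 b e he
    rw [he0, map_zero] at h1
    refine h ⟨?_, h1.symm⟩
    by_contra hi
    rw [(hf 0).2 (by simpa using Ne.symm hi)] at he
    exact he rfl
  | succ k => exact PEmpty.elim b

/-- The trivial resolution has one generator, of bidegree `(0, 0)`, so modulo all variables it is
`K` there. -/
theorem hdim_trivialResolution (i j : ℤ) :
    ((trivialResolution σ K).modVars Set.univ).hdim i j = if i = 0 ∧ j = 0 then 1 else 0 := by
  split_ifs with h
  · obtain ⟨rfl, rfl⟩ := h
    let F := trivialResolution σ K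
    let o : F.gen 0 := PUnit.unit
    let v : ∀ i, F.gen i →₀ MvPolynomial σ K := Pi.single 0 (Finsupp.single o 1)
    have hv : v ∈ F.toBicomplex.piece 0 0 := by
      refine F.single_mem_piece 0 0 fun b e he => ?_
      classical
      rw [show b = o from rfl, Finsupp.single_eq_same, coeff_one] at he
      rw [show e = 0 by simpa [eq_comm] using he]
      rfl
    have hv0 : v 0 o = 1 := by
      change (Pi.single 0 (Finsupp.single o 1) : ∀ i, F.gen i →₀ MvPolynomial σ K) 0 o = 1
      rw [Pi.single_eq_same, Finsupp.single_eq_same]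
    have hB : (F.modVars Set.univ).boundaries 0 0 = ⊥ := by
      rw [Bicomplex.boundaries, trivialResolution_piece_eq_bot (by omega), Submodule.map_bot]
    -- The map is `c ↦ c v`, with inverse the constant coefficient; `K` is written as `⊤/⊥` to fit
    -- the subquotient criterion.
    have he : Nonempty (((⊤ : Submodule K K) ⧸ (⊥ : Submodule K K).submoduleOf ⊤) ≃ₗ[K]
        (F.modVars Set.univ).homology 0 0) := by
      refine nonempty_subquotient_equiv
        ((LinearMap.id (R := K)).smulRight ((F.coeffsIn Set.univ).mkQ v)) ?_ ?_ ?_ ?_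
      · exact fun c _ => Submodule.smul_mem _ c ⟨⟨v, hv, rfl⟩, rfl⟩
      · rintro _ rfl
        rw [map_zero]
        exact zero_mem _
      · intro c _ hc
        rw [hB] at hc
        have h1 := F.mem_coeffsIn'.mp ((Submodule.Quotient.mk_eq_zero (F.coeffsIn Set.univ)).mp
          ((Submodule.mem_bot K).mp hc)) 0 o 0
        by_contra hc0
        obtain ⟨s, -, hs⟩ := h1 (by
          change coeff 0 (c • v 0 o) ≠ 0
          rw [hv0, coeff_smul, coeff_zero_one, smul_eq_mul, mul_one]
          exact hc0)
        exact hs rfl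
      · rintro _ ⟨⟨f, -, rfl⟩, -⟩
        refine ⟨coeff 0 (f 0 o), trivial, ?_⟩
        rw [hB]
        refine (Submodule.mem_bot K).mpr (sub_eq_zero.mpr ((Submodule.Quotient.eq _).mpr
          (F.mem_coeffsIn'.mpr fun k b e he => ?_)))
        cases k with
        | zero =>
          change coeff e (coeff 0 (f 0 o) • v 0 o - f 0 o) ≠ 0 at he
          rw [hv0] at he
          by_contra! h0
          rw [show e = 0 from Finsupp.ext fun s => h0 s (Set.mem_univ s), coeff_sub, coeff_smul,
            coeff_zero_one, smul_eq_mul, mul_one, sub_self] at he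
          exact he rfl
        | succ k => exact PEmpty.elim b
    obtain ⟨e⟩ := he
    have := finrank_subquotient_add (bot_le : (⊥ : Submodule K K) ≤ ⊤)
    rw [finrank_bot, finrank_top, Module.finrank_self] at this
    exact e.finrank_eq.symm.trans this
  · exact Bicomplex.hdim_eq_zero (trivialResolution_piece_eq_bot h)

theorem hdim_koszul_quotientMod_eq_zero (l : List σ) (i j : ℤ)
    (h : i < 0 ∨ (l.length : ℤ) < i ∨ j < i) :
    (Bicomplex.koszul l (quotientMod 𝔞 h𝔞).toBicomplex).hdim i j = 0 :=
  Bicomplex.hdim_eq_zero (Bicomplex.koszul_piece_eq_bot l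
    (quotientMod_piece_eq_bot 𝔞 h𝔞) i j (by omega))

/-- Both cases compare with the polynomial ring. On the diagonal, `j < i + 1` puts the bidegree in
the range where the homologies agree. Elsewhere in row `0` an upper bound suffices, and right
exactness bounds the dimension by zero. -/
theorem hdim_koszul_quotientMod_diag [Finite σ] (h𝔞_top : 𝔞 ≠ ⊤)
    (h𝔞_lin : ∀ p ∈ 𝔞, p.IsHomogeneous 1 → p = 0) (l : List σ) (hl : l.Nodup)
    (hl' : ∀ s, s ∈ l) (i j : ℤ) (hij : i = j ∨ i = 0) :
    (Bicomplex.koszul l (quotientMod 𝔞 h𝔞).toBicomplex).hdim i j =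
      if i = 0 ∧ j = 0 then 1 else 0 := by
  have h1 := ((trivialResolution σ K).nonempty_koszul_equiv_modVars l hl hl' i j).elim
    LinearEquiv.finrank_eq
  have h2 := h1.trans (hdim_trivialResolution i j)
  by_cases h : i = j
  · rw [← h2]
    exact (((bijectiveBelow_quotientHom 𝔞 h𝔞 h𝔞_top h𝔞_lin).koszul l).hdim_eq (by omega)).symm
  · have h3 := ((surjectiveOnPieces_quotientHom 𝔞 h𝔞).koszul l).hdim_le
      ((locallyFinite_quotientMod _ _).koszul l) (i := i) (j := j)
      (Bicomplex.koszul_piece_eq_bot l (quotientMod_piece_eq_bot _ _) _ _ (by omega))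
    rw [if_neg (by omega)] at h2 ⊢
    exact Nat.le_zero.mp (h3.trans h2.le)

end Quotient

/-! ### Assembly -/

/-- The comparison of Betti numbers of `P ⧸ 𝔞` over `P` and over a polynomial ring with `n`
additional variables. -/
theorem betti_quotientMod_restrict {m n : ℕ} (𝔞 : Ideal (MvPolynomial (Fin m) K))
    (h𝔞 : 𝔞.IsHomogeneous (homogeneousSubmodule (Fin m) K)) (h𝔞_top : 𝔞 ≠ ⊤)
    (h𝔞_lin : ∀ p ∈ 𝔞, p.IsHomogeneous 1 → p = 0) [Finite ω]
    (π : MvPolynomial ω K →ₐ[K] MvPolynomial (Fin m) K)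
    (hπ : ∀ (k : ℕ) (p : MvPolynomial ω K), p.IsHomogeneous k → (π p).IsHomogeneous k)
    (f : Fin m → ω) (f' : Fin n → ω) (hff' : Function.Bijective (Sum.elim f f'))
    (hf : ∀ s, π (X (f s)) = X s) (hf' : ∀ s, π (X (f' s)) = 0) :
    let A : GrMod (Fin m) K := quotientMod 𝔞 h𝔞
    let AQ : GrMod ω K := A.restrict π hπ
    (∀ i j, Module.Finite K (gradedTor A i j)) ∧ (∀ i j, Module.Finite K (gradedTor AQ i j)) ∧
    poincare AQ = poincare A * (1 + sVar * tVar) ^ n ∧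
    strictPart (poincare AQ) = (poincare A - 1) * (1 + sVar * tVar) ^ n ∧
    (∀ (i : ℕ) (j : ℤ), j ≠ i → betti AQ i j =
      ∑ l ∈ Finset.range (min i m), n.choose ((i - m) + l) *
        betti A (min i m - l) (j - (l : ℤ) - ((i - m : ℕ) : ℤ))) ∧
    ∀ i : ℕ, betti AQ i i = n.choose i := by
  intro A AQ
  have hA : A.toBicomplex.LocallyFinite := locallyFinite_quotientMod 𝔞 h𝔞
  have hnodup : ((List.finRange m).map f ++ (List.finRange n).map f').Nodup := by
    rw [List.nodup_append]
    refine ⟨(List.nodup_finRange m).map (hff'.1.comp Sum.inl_injective),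
      (List.nodup_finRange n).map (hff'.1.comp Sum.inr_injective), ?_⟩
    intro a ha b hb hab
    obtain ⟨s, -, rfl⟩ := List.mem_map.mp ha
    obtain ⟨t, -, rfl⟩ := List.mem_map.mp hb
    exact Sum.inl_ne_inr (hff'.1 (a₁ := .inl s) (a₂ := .inr t) hab)
  have hall : ∀ s, s ∈ (List.finRange m).map f ++ (List.finRange n).map f' := by
    intro s
    obtain ⟨t | t, rfl⟩ := hff'.2 s <;> simp
  -- Every Betti number is expressed through this function on all of `ℤ × ℤ`, so shifts need no case
  -- distinctions.
  set g : ℤ → ℤ → ℕ := (Bicomplex.koszul (List.finRange m) A.toBicomplex).hdim with hg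
  have hgA : ∀ (i : ℕ) (j : ℤ), betti A i j = g i j :=
    betti_eq_hdim A _ (List.nodup_finRange m) (List.mem_finRange)
  have hgAQ : ∀ (i : ℕ) (j : ℤ), betti AQ i j =
      ∑ k ∈ Finset.range (n + 1), n.choose k * g (i - k) (j - k) := by
    intro i j
    have := betti_restrict A π hπ f hf hA (List.finRange m) ((List.finRange n).map f')
      (by simpa using hf') hnodup hall i j
    rwa [List.length_map, List.length_finRange] at this
  have hneg : ∀ i j, i < 0 ∨ (m : ℤ) < i ∨ j < i → g i j = 0 := by
    have := hdim_koszul_quotientMod_eq_zero 𝔞 h𝔞 (List.finRange m)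
    rwa [List.length_finRange] at this
  have hdiag : ∀ i j, i = j ∨ i = 0 → g i j = if i = 0 ∧ j = 0 then 1 else 0 :=
    hdim_koszul_quotientMod_diag 𝔞 h𝔞 h𝔞_top h𝔞_lin (List.finRange m) (List.nodup_finRange m)
      (List.mem_finRange)
  have hPA : poincare A = seriesOf fun i j => g i j := by
    ext e
    exact congrArg Nat.cast (hgA (e 0) (e 1 : ℕ))
  have hPAQ : poincare AQ = seriesOf fun i j =>
      ∑ k ∈ Finset.range (n + 1), (n.choose k : ℤ) * g (i - k) (j - k) := by
    ext e
    refine (congrArg Nat.cast (hgAQ (e 0) (e 1 : ℕ))).trans ?_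
    rw [coeff_seriesOf]
    push_cast
    rfl
  refine ⟨finite_gradedTor A hA, finite_gradedTor AQ (locallyFinite_restrict A π hπ f hf hA),
    ?_, ?_, fun i j hij => ?_, fun i => ?_⟩
  · rw [hPA, hPAQ, seriesOf_mul_pow]
    intro i j h
    rw [hneg i j (by omega), Nat.cast_zero]
  · rw [hPA, hPAQ, strictPart_seriesOf hneg hdiag]
  · rw [hgAQ, sum_choose_offDiag hneg hdiag i j hij]
    simp only [hgA]
  · rw [hgAQ, sum_choose_diag hdiag]

end GradedBetti

end

theorem mainTheorem7 {K : Type*} [Field K] (m n : ℕ)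
    (𝔞 : Ideal (MvPolynomial (Fin m) K)) (𝔟 : Ideal (MvPolynomial (Fin n) K))
    (h𝔞 : 𝔞.IsHomogeneous (MvPolynomial.homogeneousSubmodule (Fin m) K))
    (h𝔟 : 𝔟.IsHomogeneous (MvPolynomial.homogeneousSubmodule (Fin n) K))
    (h𝔞_top : 𝔞 ≠ ⊤) (h𝔟_top : 𝔟 ≠ ⊤)
    (h𝔞_lin : ∀ p ∈ 𝔞, p.IsHomogeneous 1 → p = 0)
    (h𝔟_lin : ∀ p ∈ 𝔟, p.IsHomogeneous 1 → p = 0) :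
    let A : GradedBetti.GrMod (Fin m) K := GradedBetti.quotientMod 𝔞 h𝔞
    let B : GradedBetti.GrMod (Fin n) K := GradedBetti.quotientMod 𝔟 h𝔟
    let AQ : GradedBetti.GrMod (Fin m ⊕ Fin n) K := GradedBetti.quotientModLeft (Fin n) 𝔞 h𝔞
    let BQ : GradedBetti.GrMod (Fin m ⊕ Fin n) K := GradedBetti.quotientModRight (Fin m) 𝔟 h𝔟
    -- all the dimensions involved are finite
    (∀ (i : ℕ) (j : ℤ),
      Module.Finite K (GradedBetti.gradedTor A i j) ∧
      Module.Finite K (GradedBetti.gradedTor B i j) ∧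
      Module.Finite K (GradedBetti.gradedTor AQ i j) ∧
      Module.Finite K (GradedBetti.gradedTor BQ i j)) ∧
    -- the Poincaré series
    GradedBetti.poincare AQ =
      GradedBetti.poincare A * (1 + GradedBetti.sVar * GradedBetti.tVar) ^ n ∧
    GradedBetti.poincare BQ =
      GradedBetti.poincare B * (1 + GradedBetti.sVar * GradedBetti.tVar) ^ m ∧
    -- their parts in which the exponent of `s` exceeds that of `t`
    GradedBetti.strictPart (GradedBetti.poincare AQ) =
      (GradedBetti.poincare A - 1) * (1 + GradedBetti.sVar * GradedBetti.tVar) ^ n ∧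
    GradedBetti.strictPart (GradedBetti.poincare BQ) =
      (GradedBetti.poincare B - 1) * (1 + GradedBetti.sVar * GradedBetti.tVar) ^ m ∧
    -- the Betti numbers off the diagonal
    (∀ (i : ℕ) (j : ℤ), j ≠ i →
      GradedBetti.betti AQ i j =
        ∑ l ∈ Finset.range (min i m), n.choose ((i - m) + l) *
          GradedBetti.betti A (min i m - l) (j - (l : ℤ) - ((i - m : ℕ) : ℤ)) ∧
      GradedBetti.betti BQ i j =
        ∑ l ∈ Finset.range (min i n), m.choose ((i - n) + l) *
          GradedBetti.betti B (min i n - l) (j - (l : ℤ) - ((i - n : ℕ) : ℤ))) ∧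
    -- the Betti numbers on the diagonal
    (∀ i : ℕ, GradedBetti.betti AQ i i = n.choose i ∧ GradedBetti.betti BQ i i = m.choose i) := by

  intro A B AQ BQ
  obtain ⟨hA1, hA2, hA3, hA4, hA5, hA6⟩ := GradedBetti.betti_quotientMod_restrict (n := n)
    𝔞 h𝔞 h𝔞_top h𝔞_lin (GradedBetti.projLeft (Fin m) (Fin n) K)
    GradedBetti.projLeft_isHomogeneous Sum.inl Sum.inr (by
      rw [Sum.elim_inl_inr]
      exact Function.bijective_id)
    (fun s => by simp [GradedBetti.projLeft]) (fun s => by simp [GradedBetti.projLeft])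
  -- The same statement with the roles of the two sets of variables exchanged.
  obtain ⟨hB1, hB2, hB3, hB4, hB5, hB6⟩ := GradedBetti.betti_quotientMod_restrict (n := m)
    𝔟 h𝔟 h𝔟_top h𝔟_lin (GradedBetti.projRight (Fin m) (Fin n) K)
    GradedBetti.projRight_isHomogeneous Sum.inr Sum.inl (Equiv.sumComm (Fin n) (Fin m)).bijective
    (fun s => by simp [GradedBetti.projRight]) (fun s => by simp [GradedBetti.projRight])
  exact ⟨fun i j => ⟨hA1 i j, hB1 i j, hA2 i j, hB2 i j⟩, hA3, hB3, hA4, hB4,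
    fun i j hij => ⟨hA5 i j hij, hB5 i j hij⟩, fun i => ⟨hA6 i, hB6 i⟩⟩
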